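/- Let $(p_n)_{n\ge 1}$ be a sequence of positive integers with $\log p_n = o(n^{1/4})$. For each $n$ let $X^n=(X^n_1,\dots,X^n_n)$ be i.i.d. random vectors in $\mathbb{R}^{p_n}$ (the $n$-th row of a triangular array; their common law may depend on $n$), write $X^n_{i,k}$ for the $k$-th coordinate of $X^n_i$, and suppose that $$\sup_n \Big\| \max_{k\le p_n} |X^n_{1,k}| \Big\|_{L_{12}} < \infty .$$ Let $Y^n=(Y^n_1,\dots,Y^n_n)$ be an independent copy of $X^n$, let $\bar X^n = \frac1n\sum_{i\le n} X^n_i$, and let $Z^n=(Z^n_1,\dots,Z^n_n)$ be an empirical bootstrap sample: conditionally on $X^n$, the $Z^n_i$ are i.i.d. with law $\frac1n\sum_{i\le n}\delta_{X^n_i}$. For $x_1,\dots,x_n\in\mathbb{R}^{p_n}$ put $$\mathcal{M}_n(x_1,\dots,x_n) = \max_{j\le p_n} \frac{1}{\sqrt n}\sum_{i\le n} x_{i,j}.$$ Let $\mathcal F$ be the class of functions $h\in C^3(\mathbb{R})$ with $\sup_{x\in\mathbb{R}}|h^{(i)}(x)|\le 1$ for $i=1,2,3$, and for real random variables $U,V$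 let $$d_{\mathcal F}(U,V\mid X^n) = \sup_{h\in\mathcal F}\big( \mathbb{E}[h(U)\mid X^n]-\mathbb{E}[h(V)\mid X^n]\big),$$ where the conditional expectations are computed from regular conditional laws given $X^n$. Then this quantity is a (measurable) random variable for $U=\mathcal{M}_n(Z^n_1-\bar X^n,\dots,Z^n_n-\bar X^n)$ and $V=\mathcal{M}_n(Y^n_1-\mathbb{E}[Y^n_1],\dots,Y^n_n-\mathbb{E}[Y^n_1])$, and $$\Big\| d_{\mathcal F}\big(\mathcal{M}_n(Z^n-\bar X^n),\ \mathcal{M}_n(Y^n-\mathbb{E}[Y^n_1])\mid X^n\big)\Big\|_{L_1} \longrightarrow 0 \qquad (n\to\infty).$$ -/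

import Mathlib

open MeasureTheory ProbabilityTheory Filter Topology
open scoped ENNReal NNReal

noncomputable section

namespace Bootstrap

/-- The class `𝓕` of three times continuously differentiable functions on `ℝ` whose derivatives
of orders one, two and three are bounded by `1` in absolute value. -/
def testClass : Set (ℝ → ℝ) :=
  {h | ContDiff ℝ 3 h ∧ ∀ i : ℕ, 1 ≤ i → i ≤ 3 → ∀ x : ℝ, |iteratedDeriv i h x| ≤ 1}

/-- The distance `d_𝓕(μ, ν) = sup_{h ∈ 𝓕} (∫ h dμ - ∫ h dν)`. The class `𝓕` is stable under
`h ↦ -h`, so the supremum is nonnegative and can be taken in `[0, ∞]`. Functions in `𝓕` are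
Lipschitz, so the integrals make sense for laws with a finite first moment. -/
def dF (μ ν : Measure ℝ) : ℝ≥0∞ :=
  ⨆ h ∈ testClass, ENNReal.ofReal (∫ x, h x ∂μ - ∫ x, h x ∂ν)

/-- The random distance `d_𝓕(U, V ∣ W)`: the distance `d_𝓕` between the (regular) conditional
laws of the real random variables `U` and `V` given `W`. -/
def dFCond {Ω E : Type*} [MeasurableSpace Ω] [MeasurableSpace E] (P : Measure Ω)
    [IsFiniteMeasure P] (U V : Ω → ℝ) (W : Ω → E) (ω : Ω) : ℝ≥0∞ :=
  dF (condDistrib U W P (W ω)) (condDistrib V W P (W ω))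

/-- The random variables `X 0, …, X (n-1)` are independent with common law `ν`. -/
def IsIIDSample {Ω E : Type*} [MeasurableSpace Ω] [MeasurableSpace E] {n : ℕ}
    (X : Ω → Fin n → E) (ν : Measure E) (P : Measure Ω) : Prop :=
  Measurable X ∧ iIndepFun (fun i ω => X ω i) P ∧ ∀ i, HasLaw (fun ω => X ω i) ν P

/-- `Y` is an independent copy of `X`. -/
def IsIndependentCopy {Ω E : Type*} [MeasurableSpace Ω] [MeasurableSpace E]
    (Y X : Ω → E) (P : Measure Ω) : Prop :=
  Measurable Y ∧ IndepFun X Y P ∧ IdentDistrib Y X P P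

/-- The empirical measure `n⁻¹ ∑ i, δ_{x i}` of a sample of size `n`: the law of a uniform draw
from the observations `x 0, …, x (n-1)`, counted with multiplicity. -/
def empiricalMeasure {E : Type*} [MeasurableSpace E] {n : ℕ} (x : Fin n → E) : Measure E :=
  (n : ℝ≥0∞)⁻¹ • ∑ i, Measure.dirac (x i)

/-- `Z` is an empirical bootstrap sample of `X`: conditionally on `X`, the `n` coordinates of `Z`
are independent uniform draws with replacement from the observations. -/
def IsBootstrapSample {Ω E : Type*} [MeasurableSpace Ω] [MeasurableSpace E]
    [StandardBorelSpace E] [Nonempty E] {n : ℕ}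
    (Z X : Ω → Fin n → E) (P : Measure Ω) [IsFiniteMeasure P] : Prop :=
  Measurable Z ∧
    ∀ᵐ x ∂(P.map X), condDistrib Z X P x = Measure.pi (fun _ : Fin n => empiricalMeasure x)

/-- The statistic `𝓜_n(x) = max_j n^{-1/2} ∑ i, x i j`. -/
def maxStat {n p : ℕ} (x : Fin n → Fin p → ℝ) : ℝ :=
  ⨆ j : Fin p, (√(n : ℝ))⁻¹ * ∑ i, x i j

/-- The sample mean `n⁻¹ ∑ i, x i`. -/
def sampleMean {n p : ℕ} (x : Fin n → Fin p → ℝ) : Fin p → ℝ :=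
  fun j => (n : ℝ)⁻¹ * ∑ i, x i j

/-- The mean vector of a law on `ℝ^p`. -/
def meanVec {p : ℕ} (ν : Measure (Fin p → ℝ)) : Fin p → ℝ :=
  fun j => ∫ x, x j ∂ν

end Bootstrap

end

noncomputable section

namespace Bootstrap

/-! ### Taylor remainders on the unit interval -/

section Taylor

/-! Conditionally on the sample, both statistics are maxima of normalized sums of independent
centered vectors: under the empirical law of the centered observations on one side, under the true
centered law on the other. Two such maxima are close as soon as the two covariance matrices are
entrywise close and third moments are controlled. The maximum is replaced by `lse b`, at a cost of
`log p / b`. The summands are then exchanged one at a time by Lindeberg's method: first-order Taylor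
terms vanish by centering, second-order terms cost about `b` times the entrywise covariance error
`Δ`, and third-order terms cost about `b ^ 2 * n ^ (-1/2)` times third moments of the sup norm.
Derivatives of `lse` are moments under softmax weights, which sum to one, so no power of `p`
appears. This is `integral_maxStat_sub_le`.

For the bootstrap, `Δ` is random. It is at most the sup norm of a normalized sum of centered
matrices plus the squared norm of the sample mean. Both are averaged by a maximal inequality
(`integral_norm_sum_le`), itself proved with `lse`: each independent centered summand raises the
expected smooth maximum by at most `2 * b * E ‖u‖ ^ 2`. Fourth moments suffice for this.

With `t = n ^ (-1/8)` and `ε = √(log p * t ^ 2) + t → 0`, the choice `b = ε / t ^ 2` makes all three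
costs vanish: `log p / b` is at most `√(log p * t ^ 2)`, the expected `Δ` is of order `t ^ 2` and so
costs order `ε + t ^ 2`, and `b ^ 2 * n ^ (-1/2) = ε ^ 2`. The identification of the conditional
laws and the measurability of the supremum are separate, softer arguments. -/

theorem abs_sub_taylor_one_le {g g₁ g₂ : ℝ → ℝ} {M : ℝ} (h₁ : ∀ t, HasDerivAt g (g₁ t) t)
    (h₂ : ∀ t, HasDerivAt g₁ (g₂ t) t) (hM : ∀ t, |g₂ t| ≤ M) {t : ℝ} (ht : t ∈ Set.Icc (0 : ℝ) 1) :
    |g t - g 0 - t * g₁ 0| ≤ M := by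
  have hM0 : 0 ≤ M := (abs_nonneg _).trans (hM 0)
  have key : ∀ s ∈ Set.Icc (0 : ℝ) 1, ‖g₁ s - g₁ 0‖ ≤ M := fun s hs => by
    refine (norm_image_sub_le_of_norm_deriv_le_segment' (fun x _ => (h₂ x).hasDerivWithinAt)
      (fun x _ => hM x) s hs).trans ?_
    nlinarith [hs.1, hs.2]
  have h := norm_image_sub_le_of_norm_deriv_le_segment' (a := 0) (b := 1)
    (f := fun s => g s - s * g₁ 0)
    (fun x _ => ((h₁ x).sub ((hasDerivAt_id x).mul_const (g₁ 0))).hasDerivWithinAt)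
    (C := M) (fun x hx => by simpa using key x ⟨hx.1, hx.2.le⟩) t ht
  rw [Real.norm_eq_abs] at h
  have e : g t - g 0 - t * g₁ 0 = g t - t * g₁ 0 - (g 0 - 0 * g₁ 0) := by ring
  rw [e]
  exact h.trans (by nlinarith [ht.1, ht.2])

/-- The mean value inequality applied to `g` minus its quadratic polynomial, whose derivative is the
first-order remainder of `g₁`. Sharp factorials are not needed. -/
theorem abs_sub_taylor_two_le {g g₁ g₂ g₃ : ℝ → ℝ} {M : ℝ} (h₁ : ∀ t, HasDerivAt g (g₁ t) t)
    (h₂ : ∀ t, HasDerivAt g₁ (g₂ t) t) (h₃ : ∀ t, HasDerivAt g₂ (g₃ t) t)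
    (hM : ∀ t, |g₃ t| ≤ M) :
    |g 1 - g 0 - g₁ 0 - g₂ 0 / 2| ≤ M := by
  have hM0 : 0 ≤ M := (abs_nonneg _).trans (hM 0)
  have h := norm_image_sub_le_of_norm_deriv_le_segment' (a := 0) (b := 1)
    (f := fun s => g s - s * g₁ 0 - s ^ 2 * (g₂ 0 / 2))
    (fun x _ => (((h₁ x).sub ((hasDerivAt_id x).mul_const (g₁ 0))).sub
      ((hasDerivAt_pow 2 x).mul_const (g₂ 0 / 2))).hasDerivWithinAt)
    (C := M) (fun x hx => by
      have := abs_sub_taylor_one_le h₂ h₃ hM (t := x) ⟨hx.1, hx.2.le⟩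
      rw [Real.norm_eq_abs]
      convert this using 2
      simp; ring) 1 (by simp)
  rw [Real.norm_eq_abs] at h
  convert h using 2 <;> ring

end Taylor

/-! ### The smooth maximum and its directional derivatives -/

section LogSumExp

variable {ι : Type*} [Fintype ι]

/-- The smooth maximum `b⁻¹ log ∑ j, exp (b x j)`. -/
def lse (b : ℝ) (x : ι → ℝ) : ℝ := b⁻¹ * Real.log (∑ j, Real.exp (b * x j))

/-- The `k`-th moment of `u` under the softmax weights of `b x`. -/
def tiltMoment (b : ℝ) (x u : ι → ℝ) (k : ℕ) : ℝ :=
  (∑ j, Real.exp (b * x j) * u j ^ k) / ∑ j, Real.exp (b * x j)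

theorem hasDerivAt_sum_exp_mul_pow (b : ℝ) (s u : ι → ℝ) (k : ℕ) (t : ℝ) :
    HasDerivAt (fun t : ℝ => ∑ j, Real.exp (b * (s + t • u) j) * u j ^ k)
      (b * ∑ j, Real.exp (b * (s + t • u) j) * u j ^ (k + 1)) t := by
  rw [Finset.mul_sum]
  refine HasDerivAt.fun_sum fun j _ => ?_
  have h : HasDerivAt (fun t : ℝ => b * (s + t • u) j) (b * u j) t := by
    simpa using ((((hasDerivAt_id t).mul_const (u j)).const_add (s j)).const_mul b)
  refine (h.exp.mul_const (u j ^ k)).congr_deriv ?_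
  ring

theorem hasDerivAt_sum_exp (b : ℝ) (s u : ι → ℝ) (t : ℝ) :
    HasDerivAt (fun t : ℝ => ∑ j, Real.exp (b * (s + t • u) j))
      (b * ∑ j, Real.exp (b * (s + t • u) j) * u j) t := by
  simpa using hasDerivAt_sum_exp_mul_pow b s u 0 t

variable [Nonempty ι]

theorem sum_exp_pos (b : ℝ) (x : ι → ℝ) : 0 < ∑ j, Real.exp (b * x j) :=
  Finset.sum_pos (fun _ _ => Real.exp_pos _) Finset.univ_nonempty

theorem le_lse {b : ℝ} (hb : 0 < b) (x : ι → ℝ) (j : ι) : x j ≤ lse b x := by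
  rw [lse, le_inv_mul_iff₀ hb, Real.le_log_iff_exp_le (sum_exp_pos b x)]
  exact Finset.single_le_sum (f := fun j => Real.exp (b * x j))
    (fun _ _ => (Real.exp_pos _).le) (Finset.mem_univ j)

theorem lse_le {b : ℝ} (hb : 0 < b) (x : ι → ℝ) {m : ℝ} (hm : ∀ j, x j ≤ m) :
    lse b x ≤ m + Real.log (Fintype.card ι) / b := by
  have hc : (0 : ℝ) < Fintype.card ι := by exact_mod_cast Fintype.card_pos
  have : Real.log (∑ j, Real.exp (b * x j)) ≤ b * m + Real.log (Fintype.card ι) := by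
    rw [Real.log_le_iff_le_exp (sum_exp_pos b x), Real.exp_add, Real.exp_log hc]
    calc ∑ j, Real.exp (b * x j) ≤ ∑ _j : ι, Real.exp (b * m) :=
          Finset.sum_le_sum fun j _ => Real.exp_le_exp.2 (mul_le_mul_of_nonneg_left (hm j) hb.le)
      _ = _ := by simp [mul_comm]
  rw [lse, inv_mul_le_iff₀ hb]
  calc _ ≤ _ := this
    _ = _ := by field_simp

theorem abs_tiltMoment_le (b : ℝ) (x u : ι → ℝ) (k : ℕ) : |tiltMoment b x u k| ≤ ‖u‖ ^ k := by
  rw [tiltMoment, abs_div, abs_of_pos (sum_exp_pos b x), div_le_iff₀ (sum_exp_pos b x),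
    Finset.mul_sum]
  refine (Finset.abs_sum_le_sum_abs _ _).trans (Finset.sum_le_sum fun j _ => ?_)
  rw [abs_mul, Real.abs_exp, mul_comm, abs_pow]
  gcongr
  exact norm_le_pi_norm u j

theorem hasDerivAt_lse {b : ℝ} (hb : b ≠ 0) (s u : ι → ℝ) (t : ℝ) :
    HasDerivAt (fun t : ℝ => lse b (s + t • u)) (tiltMoment b (s + t • u) u 1) t := by
  have hz := sum_exp_pos b (s + t • u)
  refine (((hasDerivAt_sum_exp b s u t).log hz.ne').const_mul b⁻¹).congr_deriv ?_
  simp only [tiltMoment, pow_one]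
  field_simp

/-- Quotient rule: moving along `u` changes a softmax average at the rate `b` times its softmax
covariance with `u`. Iterating this yields all derivatives of `lse`. -/
theorem hasDerivAt_tiltMoment (b : ℝ) (s u : ι → ℝ) (k : ℕ) (t : ℝ) :
    HasDerivAt (fun t : ℝ => tiltMoment b (s + t • u) u k)
      (b * (tiltMoment b (s + t • u) u (k + 1) -
        tiltMoment b (s + t • u) u k * tiltMoment b (s + t • u) u 1)) t := by
  have hz := sum_exp_pos b (s + t • u)
  refine ((hasDerivAt_sum_exp_mul_pow b s u k t).div (hasDerivAt_sum_exp b s u t)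
    hz.ne').congr_deriv ?_
  simp only [tiltMoment, pow_one]
  field_simp

/-- The directional derivative is a weighted average of the coordinates of the direction, so the
constant depends on neither `b` nor the dimension. -/
theorem lse_lipschitzWith {b : ℝ} (hb : b ≠ 0) : LipschitzWith 1 (lse (ι := ι) b) := by
  refine LipschitzWith.of_dist_le_mul fun y s => ?_
  have h := norm_image_sub_le_of_norm_deriv_le_segment_01'
    (f := fun t : ℝ => lse b (s + t • (y - s)))
    (fun x _ => (hasDerivAt_lse hb s (y - s) x).hasDerivWithinAt)
    (C := ‖y - s‖) (fun x _ => by simpa using abs_tiltMoment_le b (s + x • (y - s)) (y - s) 1)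
  simpa [Real.dist_eq, dist_eq_norm] using h

theorem abs_tilt_cumulant_two_le {b : ℝ} (hb : 0 < b) (x u : ι → ℝ) :
    |b * (tiltMoment b x u 2 - tiltMoment b x u 1 * tiltMoment b x u 1)| ≤ 2 * b * ‖u‖ ^ 2 := by
  have h1 := abs_tiltMoment_le b x u 1
  have h2 := abs_tiltMoment_le b x u 2
  have : |tiltMoment b x u 1 * tiltMoment b x u 1| ≤ ‖u‖ ^ 1 * ‖u‖ ^ 1 := by
    rw [abs_mul]; gcongr
  rw [abs_mul, abs_of_pos hb]
  have := abs_sub (tiltMoment b x u 2) (tiltMoment b x u 1 * tiltMoment b x u 1)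
  nlinarith

/-- The one-step estimate behind the maximal inequality: the linear term integrates to zero for
centered `u`, leaving only the quadratic one. -/
theorem lse_add_le {b : ℝ} (hb : 0 < b) (s u : ι → ℝ) :
    lse b (s + u) ≤ lse b s + tiltMoment b s u 1 + 2 * b * ‖u‖ ^ 2 := by
  have h := abs_sub_taylor_one_le (g := fun t : ℝ => lse b (s + t • u))
    (fun t => hasDerivAt_lse hb.ne' s u t) (fun t => hasDerivAt_tiltMoment b s u 1 t)
    (fun t => abs_tilt_cumulant_two_le hb (s + t • u) u) (t := 1) (by simp)
  have := (abs_le.1 h).2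
  simp at this
  linarith

end LogSumExp

/-! ### Third-order expansion of test functions of the smooth maximum -/

section Smooth

theorem hasDerivAt_iteratedDeriv_of_mem_testClass {h : ℝ → ℝ} (hh : h ∈ testClass) {k : ℕ}
    (hk : k < 3) (x : ℝ) : HasDerivAt (iteratedDeriv k h) (iteratedDeriv (k + 1) h x) x := by
  rw [iteratedDeriv_succ]
  exact ((hh.1.differentiable_iteratedDeriv k (by exact_mod_cast hk)) x).hasDerivAt

theorem lipschitzWith_of_mem_testClass {h : ℝ → ℝ} (hh : h ∈ testClass) : LipschitzWith 1 h := by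
  have hd : ∀ x, HasDerivAt h (iteratedDeriv 1 h x) x := fun x => by
    simpa using hasDerivAt_iteratedDeriv_of_mem_testClass hh (k := 0) (by norm_num) x
  refine lipschitzWith_of_nnnorm_deriv_le (fun x => (hd x).differentiableAt) fun x => ?_
  rw [(hd x).deriv]
  exact_mod_cast hh.2 1 le_rfl (by norm_num) x

variable {ι : Type*} [Fintype ι] [Nonempty ι]

theorem abs_comp_lse_taylor_le {h : ℝ → ℝ} (hh : h ∈ testClass) {b : ℝ} (hb : 0 < b)
    (s u : ι → ℝ) :
    |h (lse b (s + u)) - h (lse b s) - iteratedDeriv 1 h (lse b s) * tiltMoment b s u 1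
      - (iteratedDeriv 2 h (lse b s) * tiltMoment b s u 1 ^ 2 + iteratedDeriv 1 h (lse b s) *
        (b * (tiltMoment b s u 2 - tiltMoment b s u 1 * tiltMoment b s u 1))) / 2|
      ≤ (1 + 6 * b + 6 * b ^ 2) * ‖u‖ ^ 3 := by
  have d0 : ∀ x, HasDerivAt h (iteratedDeriv 1 h x) x := fun x => by
    simpa using hasDerivAt_iteratedDeriv_of_mem_testClass hh (k := 0) (by norm_num) x
  have d1 := hasDerivAt_iteratedDeriv_of_mem_testClass hh (k := 1) (by norm_num)
  have d2 := hasDerivAt_iteratedDeriv_of_mem_testClass hh (k := 2) (by norm_num)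
  set L : ℝ → ℝ := fun t => lse b (s + t • u)
  set m : ℕ → ℝ → ℝ := fun k t => tiltMoment b (s + t • u) u k
  have dL : ∀ t, HasDerivAt L (m 1 t) t := fun t => hasDerivAt_lse hb.ne' s u t
  have dm : ∀ k t, HasDerivAt (m k) (b * (m (k + 1) t - m k t * m 1 t)) t :=
    fun k t => hasDerivAt_tiltMoment b s u k t
  have hm : ∀ k t, |m k t| ≤ ‖u‖ ^ k := fun k t => abs_tiltMoment_le b _ u k
  have e1 : ∀ t, HasDerivAt (fun t => h (L t)) (iteratedDeriv 1 h (L t) * m 1 t) t :=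
    fun t => (d0 (L t)).comp t (dL t)
  have e2 : ∀ t, HasDerivAt (fun t => iteratedDeriv 1 h (L t) * m 1 t)
      (iteratedDeriv 2 h (L t) * m 1 t ^ 2 +
        iteratedDeriv 1 h (L t) * (b * (m 2 t - m 1 t * m 1 t))) t := fun t => by
    refine (((d1 (L t)).comp t (dL t)).mul (dm 1 t)).congr_deriv ?_
    simp only [Function.comp]; ring
  have e3 : ∀ t, HasDerivAt (fun t => iteratedDeriv 2 h (L t) * m 1 t ^ 2 +
        iteratedDeriv 1 h (L t) * (b * (m 2 t - m 1 t * m 1 t)))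
      (iteratedDeriv 3 h (L t) * m 1 t ^ 3 +
        3 * iteratedDeriv 2 h (L t) * (m 1 t * (b * (m 2 t - m 1 t * m 1 t))) +
        iteratedDeriv 1 h (L t) * (b * (b * (m 3 t - m 2 t * m 1 t) -
          2 * m 1 t * (b * (m 2 t - m 1 t * m 1 t))))) t := fun t => by
    refine ((((d2 (L t)).comp t (dL t)).mul ((dm 1 t).pow 2)).add
      (((d1 (L t)).comp t (dL t)).mul
        (((dm 2 t).sub ((dm 1 t).mul (dm 1 t))).const_mul b))).congr_deriv ?_
    simp only [Function.comp]; norm_num; ring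
  -- In the third derivative, the `h‴` term contributes `1`, the `h″` term `3 * 2 * b`, and the `h′`
  -- term `b ^ 2 * (2 + 4)`, each times `‖u‖ ^ 3`.
  have key := abs_sub_taylor_two_le e1 e2 e3 (M := (1 + 6 * b + 6 * b ^ 2) * ‖u‖ ^ 3) (fun t => by
    have a1 := hh.2 1 le_rfl (by norm_num) (L t)
    have a2 := hh.2 2 (by norm_num) (by norm_num) (L t)
    have a3 := hh.2 3 (by norm_num) le_rfl (L t)
    have m1 : |m 1 t| ≤ ‖u‖ := by simpa using hm 1 t
    have m2 := hm 2 t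
    have m3 := hm 3 t
    have c2 : |b * (m 2 t - m 1 t * m 1 t)| ≤ 2 * b * ‖u‖ ^ 2 :=
      abs_tilt_cumulant_two_le hb _ u
    have q1 : |iteratedDeriv 3 h (L t) * m 1 t ^ 3| ≤ 1 * ‖u‖ ^ 3 := by
      rw [abs_mul, abs_pow]; gcongr
    have q2 : |3 * iteratedDeriv 2 h (L t) * (m 1 t * (b * (m 2 t - m 1 t * m 1 t)))|
        ≤ 3 * 1 * (‖u‖ * (2 * b * ‖u‖ ^ 2)) := by
      rw [abs_mul, abs_mul, abs_mul]
      gcongr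
      simp
    have q3 : |b * (m 3 t - m 2 t * m 1 t)| ≤ b * (‖u‖ ^ 3 + ‖u‖ ^ 2 * ‖u‖) := by
      rw [abs_mul, abs_of_pos hb]
      gcongr
      refine (abs_sub _ _).trans ?_
      rw [abs_mul]; gcongr
    have q4 : |2 * m 1 t * (b * (m 2 t - m 1 t * m 1 t))| ≤ 2 * ‖u‖ * (2 * b * ‖u‖ ^ 2) := by
      rw [abs_mul, abs_mul]; gcongr; simp
    have q5 : |iteratedDeriv 1 h (L t) * (b * (b * (m 3 t - m 2 t * m 1 t) -
          2 * m 1 t * (b * (m 2 t - m 1 t * m 1 t))))| ≤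
        1 * (b * (b * (‖u‖ ^ 3 + ‖u‖ ^ 2 * ‖u‖) + 2 * ‖u‖ * (2 * b * ‖u‖ ^ 2))) := by
      rw [abs_mul, abs_mul, abs_of_pos hb]
      gcongr
      exact (abs_sub _ _).trans (add_le_add q3 q4)
    refine (abs_add_three _ _ _).trans ((add_le_add_three q1 q2 q5).trans (le_of_eq ?_))
    ring)
  simpa [L, m] using key

end Smooth

/-! ### Lindeberg replacement for sums of independent vectors -/

section Lindeberg

theorem integrable_lipschitz_comp {α E : Type*} [MeasurableSpace α] [NormedAddCommGroup E]
    {f : E → ℝ} {K : ℝ≥0} (hf : LipschitzWith K f) {μ : Measure α} [IsFiniteMeasure μ]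
    {g : α → E} (hg : Integrable g μ) : Integrable (fun x => f (g x)) μ := by
  refine ((integrable_const ‖f 0‖).add (hg.norm.const_mul K)).mono'
    (hf.continuous.comp_aestronglyMeasurable hg.1) (Eventually.of_forall fun x => ?_)
  have := hf.dist_le_mul (g x) 0
  rw [dist_eq_norm, dist_zero_right] at this
  have h2 := norm_sub_norm_le (f (g x)) (f 0)
  simp only [Pi.add_apply]
  linarith

theorem integrable_sum_pi {E : Type*} [NormedAddCommGroup E] [MeasurableSpace E]
    {n : ℕ} {μ : Measure E} [IsProbabilityMeasure μ] (hμ : Integrable id μ) :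
    Integrable (fun z : Fin n → E => ∑ i, z i) (Measure.pi fun _ => μ) :=
  integrable_finsetSum _ fun i _ => integrable_eval (μ := fun _ : Fin n => μ) (i := i) hμ

theorem integral_pi_succ_sum {E : Type*} [NormedAddCommGroup E] [MeasurableSpace E]
    {f : E → ℝ} (μ : Measure E) [IsProbabilityMeasure μ] (n : ℕ) (s : E) :
    ∫ z : Fin (n + 1) → E, f (s + ∑ i, z i) ∂(Measure.pi fun _ => μ) =
      ∫ a : E × (Fin n → E), f (s + a.1 + ∑ i, a.2 i) ∂(μ.prod (Measure.pi fun _ => μ)) := by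
  rw [← ((measurePreserving_piFinSuccAbove (fun _ : Fin (n + 1) => μ) 0).symm).integral_comp']
  refine integral_congr_ae (Eventually.of_forall fun a => ?_)
  simp [MeasurableEquiv.piFinSuccAbove, Fin.sum_univ_succ, add_assoc]

variable {E : Type*} [NormedAddCommGroup E] [MeasurableSpace E] [SecondCountableTopology E]

/-- Lindeberg's replacement of independent summands, one at a time. -/
theorem integral_sum_pi_le {f : E → ℝ} {K : ℝ≥0} (hf : LipschitzWith K f) {μ ν : Measure E}
    [IsProbabilityMeasure μ] [IsProbabilityMeasure ν] (hμ : Integrable id μ)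
    (hν : Integrable id ν) {δ : ℝ} (h : ∀ s, ∫ u, f (s + u) ∂μ ≤ ∫ u, f (s + u) ∂ν + δ)
    (n : ℕ) (s : E) :
    ∫ z : Fin n → E, f (s + ∑ i, z i) ∂(Measure.pi fun _ => μ) ≤
      ∫ z : Fin n → E, f (s + ∑ i, z i) ∂(Measure.pi fun _ => ν) + n * δ := by
  induction n generalizing s with
  | zero => simp
  | succ n ih =>
    have hint : ∀ (μ ν : Measure E) [IsProbabilityMeasure μ] [IsProbabilityMeasure ν],
        Integrable id μ → Integrable id ν →
        Integrable (fun a : E × (Fin n → E) => f (s + a.1 + ∑ i, a.2 i))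
          (μ.prod (Measure.pi fun _ => ν)) := fun μ ν _ _ hμ hν =>
      integrable_lipschitz_comp hf (((integrable_const s).add (hμ.comp_fst _)).add
        ((integrable_sum_pi hν).comp_snd _))
    rw [integral_pi_succ_sum, integral_pi_succ_sum]
    have i1 := hint μ μ hμ hμ
    have i2 := hint μ ν hμ hν
    have i3 := hint ν ν hν hν
    -- The induction hypothesis, at the shifted start `s + x`, replaces the last `n` summands;
    -- Fubini then brings the first one inside, where `h` applies at the start `s + ∑ i, z i`. This
    -- is why both are uniform in the starting point.
    calc ∫ a : E × (Fin n → E), f (s + a.1 + ∑ i, a.2 i) ∂(μ.prod (Measure.pi fun _ => μ))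
        = ∫ x, ∫ z : Fin n → E, f (s + x + ∑ i, z i) ∂(Measure.pi fun _ => μ) ∂μ :=
          integral_prod _ i1
      _ ≤ ∫ x, (∫ z : Fin n → E, f (s + x + ∑ i, z i) ∂(Measure.pi fun _ => ν) + n * δ) ∂μ :=
          integral_mono i1.integral_prod_left (i2.integral_prod_left.add (integrable_const _))
            fun x => ih (s + x)
      _ = ∫ x, ∫ z : Fin n → E, f (s + x + ∑ i, z i) ∂(Measure.pi fun _ => ν) ∂μ + n * δ := by
          rw [integral_add i2.integral_prod_left (integrable_const _)]; simp
      _ = ∫ z : Fin n → E, ∫ x, f (s + x + ∑ i, z i) ∂μ ∂(Measure.pi fun _ => ν) + n * δ := by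
          rw [integral_integral_swap i2]
      _ ≤ ∫ z : Fin n → E, (∫ x, f (s + x + ∑ i, z i) ∂ν + δ) ∂(Measure.pi fun _ => ν)
            + n * δ := by
          refine add_le_add_left (integral_mono i2.integral_prod_right
            (i3.integral_prod_right.add (integrable_const _)) fun z => ?_) _
          have := h (s + ∑ i, z i)
          simp only [add_right_comm s] at this
          exact this
      _ = ∫ z : Fin n → E, ∫ x, f (s + x + ∑ i, z i) ∂ν ∂(Measure.pi fun _ => ν) + δ
            + n * δ := by
          rw [integral_add i3.integral_prod_right (integrable_const _)]; simp
      _ = ∫ a : E × (Fin n → E), f (s + a.1 + ∑ i, a.2 i) ∂(ν.prod (Measure.pi fun _ => ν))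
            + (n + 1 : ℕ) * δ := by
          rw [integral_prod_symm _ i3]; push_cast; ring

/-- An additive bound for the expectation of a function of a sum of independent vectors. -/
theorem integral_sum_pi_le_of_forall [BorelSpace E] {f : E → ℝ} {K : ℝ≥0}
    (hf : LipschitzWith K f) {μ : Measure E}
    [IsProbabilityMeasure μ] (hμ : Integrable id μ) {δ : ℝ}
    (h : ∀ s, ∫ u, f (s + u) ∂μ ≤ f s + δ) (n : ℕ) (s : E) :
    ∫ z : Fin n → E, f (s + ∑ i, z i) ∂(Measure.pi fun _ => μ) ≤ f s + n * δ := by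
  -- Replacing each summand by the constant zero turns the comparison into an additive bound.
  refine (integral_sum_pi_le hf hμ (ν := Measure.dirac 0) (integrable_dirac (by simp))
    (fun s => by simpa using h s) n s).trans (le_of_eq ?_)
  congr 1
  have : ∀ᵐ z : Fin n → E ∂(Measure.pi fun _ => Measure.dirac (0 : E)), ∀ i, z i = 0 :=
    ae_all_iff.2 fun i =>
      (measurePreserving_eval (fun _ : Fin n => Measure.dirac (0 : E)) i).quasiMeasurePreserving.ae
        (p := fun x => x = 0) (by simp)
  rw [integral_congr_ae (g := fun _ => f s) (by filter_upwards [this] with z hz; simp [hz])]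
  simp

end Lindeberg

/-! ### Maximal inequality via the smooth maximum -/

section MaximalInequality

variable {ι : Type*} [Fintype ι]

theorem integral_tiltMoment_one (b : ℝ) (s : ι → ℝ) {μ : Measure (ι → ℝ)}
    (hμ : ∀ j, Integrable (fun u : ι → ℝ => u j) μ) (h0 : ∀ j, ∫ u, u j ∂μ = 0) :
    Integrable (fun u => tiltMoment b s u 1) μ ∧ ∫ u, tiltMoment b s u 1 ∂μ = 0 := by
  simp only [tiltMoment, pow_one]
  refine ⟨(integrable_finsetSum _ fun j _ => (hμ j).const_mul _).div_const _, ?_⟩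
  rw [integral_div, integral_finsetSum _ fun j _ => (hμ j).const_mul _]
  simp [integral_const_mul, h0]

/-- Starting from `lse b 0`, which is at most `log (card ι) / b`, each centered summand adds at most
the quadratic term of `lse_add_le`. -/
theorem integral_lse_sum_le [Nonempty ι] {b : ℝ} (hb : 0 < b) {μ : Measure (ι → ℝ)}
    [IsProbabilityMeasure μ] (hμ : Integrable id μ) (h2 : Integrable (fun u => ‖u‖ ^ 2) μ)
    (h0 : ∀ j, ∫ u, u j ∂μ = 0) (n : ℕ) :
    ∫ z : Fin n → ι → ℝ, lse b (∑ i, z i) ∂(Measure.pi fun _ => μ) ≤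
      Real.log (Fintype.card ι) / b + n * (2 * b * ∫ u, ‖u‖ ^ 2 ∂μ) := by
  have hc : ∀ j, Integrable (fun u : ι → ℝ => u j) μ := fun j => Integrable.eval hμ j
  have := integral_sum_pi_le_of_forall (f := lse b) (lse_lipschitzWith hb.ne') hμ
    (δ := 2 * b * ∫ u, ‖u‖ ^ 2 ∂μ) (fun s => by
      obtain ⟨t1, t2⟩ := integral_tiltMoment_one b s hc h0
      calc ∫ u, lse b (s + u) ∂μ
          ≤ ∫ u, (lse b s + tiltMoment b s u 1 + 2 * b * ‖u‖ ^ 2) ∂μ :=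
            integral_mono (integrable_lipschitz_comp (lse_lipschitzWith hb.ne')
              ((integrable_const s).add hμ)) (((integrable_const _).add t1).add (h2.const_mul _))
              fun u => lse_add_le hb s u
        _ = _ := by
            have e : ∫ u, (lse b s + tiltMoment b s u 1) ∂μ = lse b s :=
              (integral_add (integrable_const _) t1).trans (by simp [t2])
            exact (integral_add ((integrable_const _).add t1) (h2.const_mul _)).trans
              (by rw [integral_const_mul]; exact congrArg (· + _) e)) n 0
  simp only [zero_add] at this
  refine this.trans (add_le_add_left ?_ _)
  simpa using lse_le hb (0 : ι → ℝ) (m := 0) (by simp)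

/-- A maximal inequality for the coordinates of a centered sum of independent vectors. -/
theorem integral_norm_sum_le [Nonempty ι] {b : ℝ} (hb : 0 < b) {μ : Measure (ι → ℝ)}
    [IsProbabilityMeasure μ] (hμ : Integrable id μ) (h2 : Integrable (fun u => ‖u‖ ^ 2) μ)
    (h0 : ∀ j, ∫ u, u j ∂μ = 0) (n : ℕ) :
    ∫ z : Fin n → ι → ℝ, ‖∑ i, z i‖ ∂(Measure.pi fun _ => μ) ≤
      Real.log (2 * Fintype.card ι) / b + n * (2 * b * ∫ u, ‖u‖ ^ 2 ∂μ) := by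
  -- Adjoining the negated coordinates makes the sup norm a maximum without absolute values, hence
  -- the `2` inside the logarithm.
  let T : (ι → ℝ) → (ι ⊕ ι → ℝ) := fun u => Sum.elim u (-u)
  have hTm : Measurable T := by
    refine measurable_pi_lambda _ fun j => ?_
    rcases j with j | j
    · exact measurable_pi_apply j
    · exact (measurable_pi_apply j).neg
  have hTn : ∀ u, ‖T u‖ = ‖u‖ := fun u => by
    refine le_antisymm ((pi_norm_le_iff_of_nonneg (norm_nonneg _)).2 fun j => ?_)
      ((pi_norm_le_iff_of_nonneg (norm_nonneg _)).2 fun j => norm_le_pi_norm (T u) (Sum.inl j))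
    rcases j with j | j
    · exact norm_le_pi_norm u j
    · simpa [T] using norm_le_pi_norm u j
  have hTs : ∀ (z : Fin n → ι → ℝ), ∑ i, T (z i) = T (∑ i, z i) := fun z => by
    ext j
    rcases j with j | j <;> simp [T]
  have hTi : Integrable T μ := hμ.norm.mono' hTm.aestronglyMeasurable
    (Eventually.of_forall fun u => (hTn u).le)
  have : IsProbabilityMeasure (μ.map T) := Measure.isProbabilityMeasure_map hTm.aemeasurable
  have key := integral_lse_sum_le hb (μ := μ.map T)
    ((integrable_map_measure aestronglyMeasurable_id hTm.aemeasurable).2 hTi)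
    ((integrable_map_measure (by fun_prop) hTm.aemeasurable).2
      (by simpa [Function.comp_def, hTn] using h2))
    (fun j => by
      rw [integral_map hTm.aemeasurable (measurable_pi_apply j).aestronglyMeasurable]
      rcases j with j | j
      · exact h0 j
      · simpa [T, integral_neg] using h0 j) n
  rw [integral_map hTm.aemeasurable (by fun_prop)] at key
  simp only [hTn] at key
  have hcard : ((Fintype.card (ι ⊕ ι) : ℕ) : ℝ) = 2 * Fintype.card ι := by
    rw [Fintype.card_sum]; push_cast; ring
  rw [hcard] at key
  refine le_trans ?_ key
  have hpi : (Measure.pi fun _ : Fin n => μ).map (fun z i => T (z i)) =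
      Measure.pi fun _ : Fin n => μ.map T :=
    Measure.pi_map_pi (fun _ => hTm.aemeasurable)
  have hcont : Continuous (fun z : Fin n → ι ⊕ ι → ℝ => lse b (∑ i, z i)) :=
    (lse_lipschitzWith hb.ne').continuous.comp (by fun_prop)
  have hmm : Measurable (fun (z : Fin n → ι → ℝ) i => T (z i)) :=
    measurable_pi_lambda _ fun i => hTm.comp (measurable_pi_apply i)
  rw [← hpi, integral_map hmm.aemeasurable hcont.aestronglyMeasurable]
  simp only [hTs]
  have hTsum : Integrable (fun z : Fin n → ι → ℝ => T (∑ i, z i)) (Measure.pi fun _ => μ) :=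
    (integrable_sum_pi hμ).norm.mono' (hTm.comp (by fun_prop)).aestronglyMeasurable
      (Eventually.of_forall fun u => (hTn _).le)
  refine integral_mono (integrable_sum_pi hμ).norm
    (integrable_lipschitz_comp (lse_lipschitzWith hb.ne') hTsum) fun z => ?_
  have hle : ∀ j, ‖(∑ i, z i) j‖ ≤ lse b (T (∑ i, z i)) := fun j => by
    rw [Real.norm_eq_abs, abs_le']
    exact ⟨le_lse hb (T (∑ i, z i)) (Sum.inl j), le_lse hb (T (∑ i, z i)) (Sum.inr j)⟩
  obtain ⟨j⟩ := ‹Nonempty ι›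
  exact (pi_norm_le_iff_of_nonneg ((norm_nonneg _).trans (hle j))).2 hle

end MaximalInequality

/-! ### Exchanging one summand: comparison of moments -/

section SmoothComparison

theorem integrable_norm_pow_of_le {α E : Type*} [MeasurableSpace α] [NormedAddCommGroup E]
    {μ : Measure α} [IsFiniteMeasure μ] {g : α → E} (hg : AEStronglyMeasurable g μ) {k m : ℕ}
    (hkm : k ≤ m) (hm : Integrable (fun u => ‖g u‖ ^ m) μ) : Integrable (fun u => ‖g u‖ ^ k) μ := by
  refine ((integrable_const (1 : ℝ)).add hm).mono' (hg.norm.pow k)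
    (Eventually.of_forall fun u => ?_)
  rw [norm_pow, norm_norm]
  simp only [Pi.add_apply]
  rcases le_total ‖g u‖ 1 with h | h
  · exact (pow_le_one₀ (norm_nonneg _) h).trans (le_add_of_nonneg_right (by positivity))
  · exact (pow_le_pow_right₀ h hkm).trans (le_add_of_nonneg_left zero_le_one)

variable {ι : Type*} [Fintype ι]

/-- The softmax weights of `b x`. -/
def tiltWeight (b : ℝ) (x : ι → ℝ) (j : ι) : ℝ :=
  Real.exp (b * x j) / ∑ k, Real.exp (b * x k)

theorem tiltWeight_nonneg (b : ℝ) (x : ι → ℝ) (j : ι) : 0 ≤ tiltWeight b x j :=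
  div_nonneg (Real.exp_pos _).le (Finset.sum_nonneg fun _ _ => (Real.exp_pos _).le)

theorem sum_tiltWeight [Nonempty ι] (b : ℝ) (x : ι → ℝ) : ∑ j, tiltWeight b x j = 1 := by
  simp only [tiltWeight]
  rw [← Finset.sum_div, div_self (sum_exp_pos b x).ne']

theorem tiltMoment_eq_sum (b : ℝ) (x u : ι → ℝ) (k : ℕ) :
    tiltMoment b x u k = ∑ j, tiltWeight b x j * u j ^ k := by
  simp only [tiltMoment, tiltWeight, Finset.sum_div]
  exact Finset.sum_congr rfl fun j _ => by ring

theorem tiltMoment_smul (b c : ℝ) (x u : ι → ℝ) (k : ℕ) :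
    tiltMoment b x (c • u) k = c ^ k * tiltMoment b x u k := by
  simp only [tiltMoment_eq_sum, Finset.mul_sum, Pi.smul_apply, smul_eq_mul, mul_pow]
  exact Finset.sum_congr rfl fun j _ => by ring

theorem integrable_coord_mul {μ : Measure (ι → ℝ)} (h2 : Integrable (fun u => ‖u‖ ^ 2) μ)
    (j k : ι) : Integrable (fun u : ι → ℝ => u j * u k) μ := by
  refine h2.mono' (by fun_prop) (Eventually.of_forall fun u => ?_)
  rw [norm_mul, sq]
  exact mul_le_mul (norm_le_pi_norm u j) (norm_le_pi_norm u k) (norm_nonneg _) (norm_nonneg _)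

theorem integral_tiltMoment_two (b : ℝ) (s : ι → ℝ) {μ : Measure (ι → ℝ)}
    (h2 : Integrable (fun u => ‖u‖ ^ 2) μ) :
    Integrable (fun u => tiltMoment b s u 2) μ ∧
      ∫ u, tiltMoment b s u 2 ∂μ = ∑ j, tiltWeight b s j * ∫ u, u j * u j ∂μ := by
  have hi : ∀ j, Integrable (fun u : ι → ℝ => tiltWeight b s j * (u j * u j)) μ :=
    fun j => (integrable_coord_mul h2 j j).const_mul _
  simp only [tiltMoment_eq_sum, sq]
  refine ⟨integrable_finsetSum _ fun j _ => hi j, ?_⟩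
  rw [integral_finsetSum _ fun j _ => hi j]
  simp only [integral_const_mul]

theorem integral_tiltMoment_one_sq (b : ℝ) (s : ι → ℝ) {μ : Measure (ι → ℝ)}
    (h2 : Integrable (fun u => ‖u‖ ^ 2) μ) :
    Integrable (fun u => tiltMoment b s u 1 ^ 2) μ ∧
      ∫ u, tiltMoment b s u 1 ^ 2 ∂μ =
        ∑ j, ∑ k, tiltWeight b s j * tiltWeight b s k * ∫ u, u j * u k ∂μ := by
  have hi : ∀ j k, Integrable
      (fun u : ι → ℝ => tiltWeight b s j * tiltWeight b s k * (u j * u k)) μ :=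
    fun j k => (integrable_coord_mul h2 j k).const_mul _
  have e : ∀ u, tiltMoment b s u 1 ^ 2 =
      ∑ j, ∑ k, tiltWeight b s j * tiltWeight b s k * (u j * u k) := fun u => by
    rw [tiltMoment_eq_sum, sq, Finset.sum_mul_sum]
    exact Finset.sum_congr rfl fun j _ => Finset.sum_congr rfl fun k _ => by ring
  simp only [e]
  refine ⟨integrable_finsetSum _ fun j _ => integrable_finsetSum _ fun k _ => hi j k, ?_⟩
  rw [integral_finsetSum _ fun j _ => integrable_finsetSum _ fun k _ => hi j k]
  refine Finset.sum_congr rfl fun j _ => ?_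
  rw [integral_finsetSum _ fun k _ => hi j k]
  simp only [integral_const_mul]

variable [Nonempty ι]

theorem abs_integral_tiltMoment_two_sub_le (b : ℝ) (s : ι → ℝ) {μ ν : Measure (ι → ℝ)}
    (hμ : Integrable (fun u => ‖u‖ ^ 2) μ) (hν : Integrable (fun u => ‖u‖ ^ 2) ν) {Δ : ℝ}
    (hΔ : ∀ j k, |∫ u, u j * u k ∂μ - ∫ u, u j * u k ∂ν| ≤ Δ) :
    |∫ u, tiltMoment b s u 2 ∂μ - ∫ u, tiltMoment b s u 2 ∂ν| ≤ Δ := by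
  rw [(integral_tiltMoment_two b s hμ).2, (integral_tiltMoment_two b s hν).2,
    ← Finset.sum_sub_distrib]
  calc _ ≤ ∑ j, tiltWeight b s j * Δ := by
        refine (Finset.abs_sum_le_sum_abs _ _).trans (Finset.sum_le_sum fun j _ => ?_)
        rw [← mul_sub, abs_mul, abs_of_nonneg (tiltWeight_nonneg b s j)]
        exact mul_le_mul_of_nonneg_left (hΔ j j) (tiltWeight_nonneg b s j)
    _ = Δ := by rw [← Finset.sum_mul, sum_tiltWeight, one_mul]

/-- Squaring the softmax mean gives a quadratic form with nonnegative weights of total mass one, so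
an entrywise error passes through without a dimension factor. -/
theorem abs_integral_tiltMoment_one_sq_sub_le (b : ℝ) (s : ι → ℝ) {μ ν : Measure (ι → ℝ)}
    (hμ : Integrable (fun u => ‖u‖ ^ 2) μ) (hν : Integrable (fun u => ‖u‖ ^ 2) ν) {Δ : ℝ}
    (hΔ : ∀ j k, |∫ u, u j * u k ∂μ - ∫ u, u j * u k ∂ν| ≤ Δ) :
    |∫ u, tiltMoment b s u 1 ^ 2 ∂μ - ∫ u, tiltMoment b s u 1 ^ 2 ∂ν| ≤ Δ := by
  rw [(integral_tiltMoment_one_sq b s hμ).2, (integral_tiltMoment_one_sq b s hν).2]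
  simp only [← Finset.sum_sub_distrib]
  calc _ ≤ ∑ j, ∑ k, tiltWeight b s j * tiltWeight b s k * Δ := by
        refine (Finset.abs_sum_le_sum_abs _ _).trans (Finset.sum_le_sum fun j _ => ?_)
        refine (Finset.abs_sum_le_sum_abs _ _).trans (Finset.sum_le_sum fun k _ => ?_)
        have hw := mul_nonneg (tiltWeight_nonneg b s j) (tiltWeight_nonneg b s k)
        rw [← mul_sub, abs_mul, abs_of_nonneg hw]
        exact mul_le_mul_of_nonneg_left (hΔ j k) hw
    _ = Δ := by
        simp only [← Finset.sum_mul, ← Finset.mul_sum, sum_tiltWeight, mul_one, one_mul]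

/-- The hypothesis of `integral_sum_pi_le` for the smoothed statistic. Under both laws the quadratic
Taylor polynomial has the same constant term and a vanishing linear term, so only second moments and
remainders differ. -/
theorem integral_comp_lse_add_le {h : ℝ → ℝ} (hh : h ∈ testClass) {b : ℝ} (hb : 0 < b)
    {c : ℝ} (hc : 0 ≤ c) {μ ν : Measure (ι → ℝ)} [IsProbabilityMeasure μ] [IsProbabilityMeasure ν]
    (hμ : Integrable (fun u => ‖u‖ ^ 3) μ) (hν : Integrable (fun u => ‖u‖ ^ 3) ν)
    (hμ0 : ∀ j, ∫ u, u j ∂μ = 0) (hν0 : ∀ j, ∫ u, u j ∂ν = 0) {Δ : ℝ}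
    (hΔ : ∀ j k, |∫ u, u j * u k ∂μ - ∫ u, u j * u k ∂ν| ≤ Δ) (s : ι → ℝ) :
    ∫ u, h (lse b (c • (s + u))) ∂μ ≤ ∫ u, h (lse b (c • (s + u))) ∂ν +
      (c ^ 2 * ((1 + 2 * b) / 2 * Δ) +
        (1 + 6 * b + 6 * b ^ 2) * c ^ 3 * (∫ u, ‖u‖ ^ 3 ∂μ + ∫ u, ‖u‖ ^ 3 ∂ν)) := by
  set K := 1 + 6 * b + 6 * b ^ 2
  set A := iteratedDeriv 1 h (lse b (c • s)) with hA
  set B := iteratedDeriv 2 h (lse b (c • s)) with hB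
  set t1 : (ι → ℝ) → ℝ := fun u => tiltMoment b (c • s) u 1 with ht1
  set t2 : (ι → ℝ) → ℝ := fun u => tiltMoment b (c • s) u 2 with ht2
  -- The second-order term is regrouped by `t1 ^ 2` and `t2`. Their coefficients are at most `1 + b`
  -- and `b` in absolute value, up to `c ^ 2 / 2`, whence the factor `(1 + 2 * b) / 2`.
  set Q : (ι → ℝ) → ℝ := fun u => h (lse b (c • s)) + A * c * t1 u +
    c ^ 2 / 2 * (B - A * b) * t1 u ^ 2 + c ^ 2 / 2 * (A * b) * t2 u
  have taylor : ∀ u, |h (lse b (c • (s + u))) - Q u| ≤ K * c ^ 3 * ‖u‖ ^ 3 := fun u => by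
    have := abs_comp_lse_taylor_le hh hb (c • s) (c • u)
    simp only [tiltMoment_smul, norm_smul, Real.norm_eq_abs, abs_of_nonneg hc, mul_pow] at this
    rw [smul_add]
    refine le_trans (le_of_eq ?_) (this.trans (le_of_eq (by ring)))
    congr 1
    simp only [Q, ht1, ht2, hA, hB]
    ring
  have hcont : Continuous fun u : ι → ℝ => h (lse b (c • (s + u))) :=
    (lipschitzWith_of_mem_testClass hh).continuous.comp
      ((lse_lipschitzWith hb.ne').continuous.comp (by fun_prop))
  have main : ∀ (ρ : Measure (ι → ℝ)) [IsProbabilityMeasure ρ],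
      Integrable (fun u => ‖u‖ ^ 3) ρ → (∀ j, ∫ u, u j ∂ρ = 0) →
      |∫ u, h (lse b (c • (s + u))) ∂ρ - (h (lse b (c • s)) +
        c ^ 2 / 2 * (B - A * b) * ∫ u, t1 u ^ 2 ∂ρ + c ^ 2 / 2 * (A * b) * ∫ u, t2 u ∂ρ)| ≤
      K * c ^ 3 * ∫ u, ‖u‖ ^ 3 ∂ρ := fun ρ _ h3 h0 => by
    have h2 : Integrable (fun u : ι → ℝ => ‖u‖ ^ 2) ρ :=
      integrable_norm_pow_of_le aestronglyMeasurable_id (by norm_num) h3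
    have h1 : Integrable (fun u : ι → ℝ => u) ρ := by
      refine (integrable_norm_iff aestronglyMeasurable_id).1 ?_
      simpa using integrable_norm_pow_of_le (k := 1)
        (aestronglyMeasurable_id (α := ι → ℝ)) (by norm_num) h3
    obtain ⟨a1, b1⟩ := integral_tiltMoment_one b (c • s) (μ := ρ) (fun j => h1.eval j) h0
    have a11 := (integral_tiltMoment_one_sq b (c • s) h2).1
    have a2 := (integral_tiltMoment_two b (c • s) h2).1
    have r1 := (integrable_const (μ := ρ) (h (lse b (c • s)))).add (a1.const_mul (A * c))
    have r2 := r1.add (a11.const_mul (c ^ 2 / 2 * (B - A * b)))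
    have r3 := r2.add (a2.const_mul (c ^ 2 / 2 * (A * b)))
    have hQ : ∫ u, Q u ∂ρ = h (lse b (c • s)) +
        c ^ 2 / 2 * (B - A * b) * ∫ u, t1 u ^ 2 ∂ρ + c ^ 2 / 2 * (A * b) * ∫ u, t2 u ∂ρ := by
      refine (integral_add' r2 (a2.const_mul _)).trans ?_
      rw [integral_add' r1 (a11.const_mul _), integral_add' (integrable_const _) (a1.const_mul _)]
      simp only [integral_const_mul, b1]
      simp [ht1, ht2]
    have hQi : Integrable Q ρ := r3
    have hf : Integrable (fun u => h (lse b (c • (s + u)))) ρ := by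
      have hd : Integrable (fun u => h (lse b (c • (s + u))) - Q u) ρ :=
        (h3.const_mul (K * c ^ 3)).mono' (hcont.aestronglyMeasurable.sub hQi.1)
          (Eventually.of_forall taylor)
      exact (hd.add hQi).congr (Eventually.of_forall fun u => sub_add_cancel _ _)
    rw [← hQ, ← integral_sub hf hQi, ← integral_const_mul]
    exact norm_integral_le_of_norm_le (f := fun u => h (lse b (c • (s + u))) - Q u)
      (h3.const_mul (K * c ^ 3)) (Eventually.of_forall fun u => taylor u)
  have m1 := (abs_le.1 (main μ hμ hμ0)).2
  have m2 := (abs_le.1 (main ν hν hν0)).1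
  have hμ2 : Integrable (fun u : ι → ℝ => ‖u‖ ^ 2) μ :=
    integrable_norm_pow_of_le aestronglyMeasurable_id (by norm_num) hμ
  have hν2 : Integrable (fun u : ι → ℝ => ‖u‖ ^ 2) ν :=
    integrable_norm_pow_of_le aestronglyMeasurable_id (by norm_num) hν
  have d1 := abs_integral_tiltMoment_one_sq_sub_le b (c • s) hμ2 hν2 hΔ
  have d2 := abs_integral_tiltMoment_two_sub_le b (c • s) hμ2 hν2 hΔ
  have hA1 : |A| ≤ 1 := hh.2 1 le_rfl (by norm_num) _
  have hB1 : |B| ≤ 1 := hh.2 2 (by norm_num) (by norm_num) _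
  have hAb : |A * b| ≤ b := by
    rw [abs_mul, abs_of_pos hb]; exact mul_le_of_le_one_left hb.le hA1
  have e1 : (B - A * b) * (∫ u, t1 u ^ 2 ∂μ - ∫ u, t1 u ^ 2 ∂ν) ≤ (1 + b) * Δ := by
    refine (le_abs_self _).trans ?_
    rw [abs_mul]
    exact mul_le_mul ((abs_sub _ _).trans (add_le_add hB1 hAb)) d1 (abs_nonneg _) (by positivity)
  have e2 : (A * b) * (∫ u, t2 u ∂μ - ∫ u, t2 u ∂ν) ≤ b * Δ := by
    refine (le_abs_self _).trans ?_
    rw [abs_mul]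
    exact mul_le_mul hAb d2 (abs_nonneg _) hb.le
  have e3 := mul_le_mul_of_nonneg_left (add_le_add e1 e2) (show 0 ≤ c ^ 2 / 2 by positivity)
  linarith

end SmoothComparison

/-! ### Comparison of the two maxima -/

section MaxStat

variable {n p : ℕ}

theorem measurable_maxStat : Measurable (maxStat : (Fin n → Fin p → ℝ) → ℝ) := by
  unfold maxStat
  exact Measurable.iSup fun j => by fun_prop

variable [Nonempty (Fin p)]

theorem abs_maxStat_le (z : Fin n → Fin p → ℝ) :
    |maxStat z| ≤ (√(n : ℝ))⁻¹ * ‖∑ i, z i‖ := by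
  have hj : ∀ j, |(√(n : ℝ))⁻¹ * ∑ i, z i j| ≤ (√(n : ℝ))⁻¹ * ‖∑ i, z i‖ := fun j => by
    rw [abs_mul, abs_of_nonneg (by positivity)]
    gcongr
    simpa using norm_le_pi_norm (∑ i, z i) j
  obtain ⟨j⟩ := ‹Nonempty (Fin p)›
  rw [abs_le]
  exact ⟨(abs_le.1 (hj j)).1.trans (le_ciSup (f := fun j => (√(n : ℝ))⁻¹ * ∑ i, z i j)
    (Set.finite_range _).bddAbove j), ciSup_le fun j => (abs_le.1 (hj j)).2⟩

theorem abs_maxStat_sub_lse_le {b : ℝ} (hb : 0 < b) (z : Fin n → Fin p → ℝ) :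
    |maxStat z - lse b ((√(n : ℝ))⁻¹ • ∑ i, z i)| ≤ Real.log p / b := by
  have h1 : maxStat z ≤ lse b ((√(n : ℝ))⁻¹ • ∑ i, z i) := ciSup_le fun j => by
    simpa using le_lse hb ((√(n : ℝ))⁻¹ • ∑ i, z i) j
  have h2 := lse_le hb ((√(n : ℝ))⁻¹ • ∑ i, z i) (m := maxStat z) fun j => by
    simpa [maxStat] using le_ciSup (f := fun j => (√(n : ℝ))⁻¹ * ∑ i, z i j)
      (Set.finite_range _).bddAbove j
  rw [Fintype.card_fin] at h2
  rw [abs_sub_comm, abs_of_nonneg (by linarith)]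
  linarith

theorem integrable_maxStat {μ : Measure (Fin p → ℝ)} [IsProbabilityMeasure μ]
    (hμ : Integrable id μ) :
    Integrable (maxStat : (Fin n → Fin p → ℝ) → ℝ) (Measure.pi fun _ => μ) :=
  ((integrable_sum_pi hμ).norm.const_mul _).mono' measurable_maxStat.aestronglyMeasurable
    (Eventually.of_forall abs_maxStat_le)

/-- Smoothing costs `log p / b` once for each law; the rest is `n` Lindeberg exchanges at scale `c =
n ^ (-1/2)`, for which `n * c ^ 2 = 1` and `n * c ^ 3 = c`. -/
theorem integral_maxStat_sub_le {h : ℝ → ℝ} (hh : h ∈ testClass) {b : ℝ} (hb : 0 < b)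
    (hn : 1 ≤ n) {μ ν : Measure (Fin p → ℝ)} [IsProbabilityMeasure μ] [IsProbabilityMeasure ν]
    (hμ : Integrable (fun u => ‖u‖ ^ 3) μ) (hν : Integrable (fun u => ‖u‖ ^ 3) ν)
    (hμ0 : ∀ j, ∫ u, u j ∂μ = 0) (hν0 : ∀ j, ∫ u, u j ∂ν = 0) {Δ : ℝ}
    (hΔ : ∀ j k, |∫ u, u j * u k ∂μ - ∫ u, u j * u k ∂ν| ≤ Δ) :
    ∫ z : Fin n → Fin p → ℝ, h (maxStat z) ∂(Measure.pi fun _ => μ) -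
      ∫ z : Fin n → Fin p → ℝ, h (maxStat z) ∂(Measure.pi fun _ => ν) ≤
      2 * (Real.log p / b) + (1 + 2 * b) / 2 * Δ +
        (1 + 6 * b + 6 * b ^ 2) * (√(n : ℝ))⁻¹ * (∫ u, ‖u‖ ^ 3 ∂μ + ∫ u, ‖u‖ ^ 3 ∂ν) := by
  set c := (√(n : ℝ))⁻¹ with hcdef
  have hc : 0 ≤ c := by positivity
  have hid : ∀ (ρ : Measure (Fin p → ℝ)) [IsProbabilityMeasure ρ],
      Integrable (fun u => ‖u‖ ^ 3) ρ → Integrable id ρ := fun ρ _ h3 => by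
    refine (integrable_norm_iff aestronglyMeasurable_id).1 ?_
    simpa using integrable_norm_pow_of_le (k := 1)
      (aestronglyMeasurable_id (α := Fin p → ℝ)) (by norm_num) h3
  have hlip : LipschitzWith (1 * (1 * ‖c‖₊))
      (fun s : Fin p → ℝ => h (lse b (c • s))) := by
    refine (lipschitzWith_of_mem_testClass hh).comp ((lse_lipschitzWith hb.ne').comp ?_)
    exact lipschitzWith_smul c
  have hstep : ∀ (ρ : Measure (Fin p → ℝ)) [IsProbabilityMeasure ρ],
      Integrable (fun u => ‖u‖ ^ 3) ρ →
      |∫ z : Fin n → Fin p → ℝ, h (maxStat z) ∂(Measure.pi fun _ => ρ) -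
        ∫ z : Fin n → Fin p → ℝ, h (lse b (c • (0 + ∑ i, z i))) ∂(Measure.pi fun _ => ρ)| ≤
        Real.log p / b := fun ρ _ h3 => by
    have hint : Integrable (fun z : Fin n → Fin p → ℝ => h (lse b (c • (0 + ∑ i, z i))))
        (Measure.pi fun _ => ρ) :=
      integrable_lipschitz_comp hlip ((integrable_const _).add (integrable_sum_pi (hid ρ h3)))
    rw [← integral_sub (integrable_lipschitz_comp (lipschitzWith_of_mem_testClass hh)
      (integrable_maxStat (hid ρ h3))) hint]
    suffices hz : ∀ z : Fin n → Fin p → ℝ,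
        ‖h (maxStat z) - h (lse b (c • (0 + ∑ i, z i)))‖ ≤ Real.log p / b by
      simpa using norm_integral_le_of_norm_le_const (μ := Measure.pi fun _ : Fin n => ρ)
        (Eventually.of_forall hz)
    intro z
    have := (lipschitzWith_of_mem_testClass hh).dist_le_mul (maxStat z) (lse b (c • ∑ i, z i))
    rw [Real.dist_eq, Real.dist_eq] at this
    rw [zero_add, Real.norm_eq_abs]
    rw [NNReal.coe_one, one_mul] at this
    exact this.trans (abs_maxStat_sub_lse_le hb z)
  have key := integral_sum_pi_le hlip (hid μ hμ) (hid ν hν)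
    (integral_comp_lse_add_le hh hb hc hμ hν hμ0 hν0 hΔ) n 0
  have s1 := (abs_le.1 (hstep μ hμ)).2
  have s2 := (abs_le.1 (hstep ν hν)).1
  have hn0 : (0 : ℝ) < n := by exact_mod_cast hn
  have hc2 : n * c ^ 2 = 1 := by
    rw [hcdef, inv_pow, Real.sq_sqrt hn0.le, mul_inv_cancel₀ hn0.ne']
  have e : ∀ x y : ℝ, n * (c ^ 2 * x + (1 + 6 * b + 6 * b ^ 2) * c ^ 3 * y) =
      x + (1 + 6 * b + 6 * b ^ 2) * c * y := fun x y => by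
    linear_combination (x + (1 + 6 * b + 6 * b ^ 2) * c * y) * hc2
  rw [e] at key
  linarith

end MaxStat

/-! ### Integration against the empirical measure -/

section Empirical

variable {E : Type*} [MeasurableSpace E] {n : ℕ}

theorem isProbabilityMeasure_empiricalMeasure (hn : 1 ≤ n) (x : Fin n → E) :
    IsProbabilityMeasure (empiricalMeasure x) := by
  refine ⟨?_⟩
  have h0 : (n : ℝ≥0∞) ≠ 0 := by exact_mod_cast (by omega : n ≠ 0)
  simp [empiricalMeasure, ENNReal.inv_mul_cancel h0 (ENNReal.natCast_ne_top n)]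

theorem integrable_empiricalMeasure [MeasurableSingletonClass E] (hn : 1 ≤ n) {F : Type*}
    [NormedAddCommGroup F] (x : Fin n → E) (f : E → F) : Integrable f (empiricalMeasure x) := by
  have h0 : (n : ℝ≥0∞) ≠ 0 := by exact_mod_cast (by omega : n ≠ 0)
  exact (integrable_finsetSum_measure.2 fun i _ => integrable_dirac (by simp)).smul_measure
    (ENNReal.inv_ne_top.2 h0)

theorem integral_empiricalMeasure [MeasurableSingletonClass E] (x : Fin n → E) (f : E → ℝ) :
    ∫ z, f z ∂(empiricalMeasure x) = (n : ℝ)⁻¹ * ∑ i, f (x i) := by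
  rw [empiricalMeasure, integral_smul_measure,
    integral_finsetSum_measure fun i _ => integrable_dirac (by simp)]
  simp

theorem map_empiricalMeasure {F : Type*} [MeasurableSpace F] {f : E → F} (hf : Measurable f)
    (x : Fin n → E) : (empiricalMeasure x).map f = empiricalMeasure (fun i => f (x i)) := by
  rw [empiricalMeasure, empiricalMeasure, Measure.map_smul]
  congr 1
  ext s hs
  rw [Measure.map_apply hf hs]
  simp [Measure.finsetSum_apply, Measure.dirac_apply' _ hs, Measure.dirac_apply' _ (hf hs),
    Set.indicator]
  rfl

end Empirical

/-! ### The comparison bound for a fixed sample -/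

section EmpiricalBound

variable {n p : ℕ}

/-- The empirical law of the centered observations. -/
def centeredEmpirical (x : Fin n → Fin p → ℝ) : Measure (Fin p → ℝ) :=
  empiricalMeasure fun i => x i - sampleMean x

/-- The entrywise deviation of `y yᵀ` from the second moment matrix of `ν`. -/
def secondMomentDev (ν : Measure (Fin p → ℝ)) (y : Fin p → ℝ) : Fin p × Fin p → ℝ :=
  fun jk => y jk.1 * y jk.2 - ∫ u, u jk.1 * u jk.2 ∂ν

theorem sampleMean_eq_smul (x : Fin n → Fin p → ℝ) : sampleMean x = (n : ℝ)⁻¹ • ∑ i, x i := by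
  ext j; simp [sampleMean]

/-- Translation invariance of the centered empirical law, which reduces the analysis to observations
with mean zero. -/
theorem centeredEmpirical_sub_const (hn : 1 ≤ n) (x : Fin n → Fin p → ℝ) (m : Fin p → ℝ) :
    centeredEmpirical (fun i => x i - m) = centeredEmpirical x := by
  have hn0 : (n : ℝ) ≠ 0 := by exact_mod_cast (by omega : n ≠ 0)
  have : sampleMean (fun i => x i - m) = sampleMean x - m := by
    ext j
    simp [sampleMean, Finset.sum_sub_distrib, mul_sub, hn0]
  simp [centeredEmpirical, this]

theorem integral_centeredEmpirical_coord (hn : 1 ≤ n) (x : Fin n → Fin p → ℝ) (j : Fin p) :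
    ∫ u, u j ∂(centeredEmpirical x) = 0 := by
  have hn0 : (n : ℝ) ≠ 0 := by exact_mod_cast (by omega : n ≠ 0)
  rw [centeredEmpirical, integral_empiricalMeasure _ fun u : Fin p → ℝ => u j]
  simp [sampleMean, Finset.sum_sub_distrib, hn0]

theorem integral_centeredEmpirical_coord_mul (hn : 1 ≤ n) (x : Fin n → Fin p → ℝ)
    (j k : Fin p) :
    ∫ u, u j * u k ∂(centeredEmpirical x) =
      (n : ℝ)⁻¹ * ∑ i, x i j * x i k - sampleMean x j * sampleMean x k := by
  have hn0 : (n : ℝ) ≠ 0 := by exact_mod_cast (by omega : n ≠ 0)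
  rw [centeredEmpirical, integral_empiricalMeasure _ fun u : Fin p → ℝ => u j * u k]
  have e : ∀ i, (x i - sampleMean x) j * (x i - sampleMean x) k =
      x i j * x i k - x i j * sampleMean x k - sampleMean x j * x i k
        + sampleMean x j * sampleMean x k := fun i => by
    simp only [Pi.sub_apply]; ring
  simp only [e, Finset.sum_add_distrib, Finset.sum_sub_distrib, ← Finset.sum_mul,
    ← Finset.mul_sum]
  have s : ∀ j, ∑ i, x i j = n * sampleMean x j := fun j => by
    simp [sampleMean, hn0]
  rw [s, s]
  simp only [Finset.sum_const, Finset.card_univ, Fintype.card_fin, nsmul_eq_mul]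
  field_simp
  ring

theorem norm_sampleMean_pow_le (hn : 1 ≤ n) (x : Fin n → Fin p → ℝ) (k : ℕ) :
    ‖sampleMean x‖ ^ k ≤ (n : ℝ)⁻¹ * ∑ i, ‖x i‖ ^ k := by
  have hn0 : (n : ℝ) ≠ 0 := by exact_mod_cast (by omega : n ≠ 0)
  have h1 : ‖sampleMean x‖ ≤ ∑ i, (n : ℝ)⁻¹ * ‖x i‖ := by
    rw [sampleMean_eq_smul, norm_smul, ← Finset.mul_sum, norm_inv, RCLike.norm_natCast]
    gcongr
    exact norm_sum_le _ _
  rw [Finset.mul_sum]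
  exact (pow_le_pow_left₀ (norm_nonneg _) h1 k).trans
    (Real.pow_arith_mean_le_arith_mean_pow Finset.univ _ _ (fun _ _ => by positivity)
      (by simp [hn0]) (fun _ _ => norm_nonneg _) k)

/-- From `(a + b) ^ 3 ≤ 4 * (a ^ 3 + b ^ 3)` and Jensen for the sample mean; the constant is `4 +
4`. -/
theorem integral_centeredEmpirical_norm_cube_le (hn : 1 ≤ n) (x : Fin n → Fin p → ℝ) :
    ∫ u, ‖u‖ ^ 3 ∂(centeredEmpirical x) ≤ 8 * ((n : ℝ)⁻¹ * ∑ i, ‖x i‖ ^ 3) := by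
  have hn0 : (n : ℝ) ≠ 0 := by exact_mod_cast (by omega : n ≠ 0)
  rw [centeredEmpirical, integral_empiricalMeasure _ fun u : Fin p → ℝ => ‖u‖ ^ 3]
  have h : ∀ i, ‖x i - sampleMean x‖ ^ 3 ≤ 4 * ‖x i‖ ^ 3 + 4 * ‖sampleMean x‖ ^ 3 := fun i => by
    refine (pow_le_pow_left₀ (norm_nonneg _) (norm_sub_le _ _) 3).trans ?_
    have := add_pow_le (norm_nonneg (x i)) (norm_nonneg (sampleMean x)) 3
    norm_num at this
    linarith
  calc (n : ℝ)⁻¹ * ∑ i, ‖x i - sampleMean x‖ ^ 3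
      ≤ (n : ℝ)⁻¹ * ∑ i, (4 * ‖x i‖ ^ 3 + 4 * ‖sampleMean x‖ ^ 3) := by
        gcongr with i; exact h i
    _ = 4 * ((n : ℝ)⁻¹ * ∑ i, ‖x i‖ ^ 3) + 4 * ‖sampleMean x‖ ^ 3 := by
        rw [Finset.sum_add_distrib, ← Finset.mul_sum]
        simp only [Finset.sum_const, Finset.card_univ, Fintype.card_fin, nsmul_eq_mul]
        field_simp
    _ ≤ _ := by linarith [norm_sampleMean_pow_le hn x 3]

theorem abs_integral_centeredEmpirical_sub_le (hn : 1 ≤ n) (ν : Measure (Fin p → ℝ))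
    (x : Fin n → Fin p → ℝ) (j k : Fin p) :
    |∫ u, u j * u k ∂(centeredEmpirical x) - ∫ u, u j * u k ∂ν| ≤
      (n : ℝ)⁻¹ * ‖∑ i, secondMomentDev ν (x i)‖ + ‖sampleMean x‖ ^ 2 := by
  have hn0 : (n : ℝ) ≠ 0 := by exact_mod_cast (by omega : n ≠ 0)
  have e : ∫ u, u j * u k ∂(centeredEmpirical x) - ∫ u, u j * u k ∂ν =
      (n : ℝ)⁻¹ * (∑ i, secondMomentDev ν (x i)) (j, k) - sampleMean x j * sampleMean x k := by
    rw [integral_centeredEmpirical_coord_mul hn]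
    simp [secondMomentDev, Finset.sum_sub_distrib, mul_sub, hn0]
    ring
  rw [e]
  refine (abs_sub _ _).trans (add_le_add ?_ ?_)
  · rw [abs_mul, abs_of_nonneg (by positivity)]
    gcongr
    exact norm_le_pi_norm (∑ i, secondMomentDev ν (x i)) (j, k)
  · rw [abs_mul, sq]
    gcongr <;> exact norm_le_pi_norm (sampleMean x) _

/-- The bound on the distance between the two statistics, as a function of the sample. -/
def bootstrapBound (b : ℝ) (ν : Measure (Fin p → ℝ)) (x : Fin n → Fin p → ℝ) : ℝ :=
  2 * (Real.log p / b) + (1 + 2 * b) / 2 *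
      ((n : ℝ)⁻¹ * ‖∑ i, secondMomentDev ν (x i)‖ + ‖sampleMean x‖ ^ 2) +
    (1 + 6 * b + 6 * b ^ 2) * (√(n : ℝ))⁻¹ *
      (8 * ((n : ℝ)⁻¹ * ∑ i, ‖x i‖ ^ 3) + ∫ u, ‖u‖ ^ 3 ∂ν)

theorem dF_map_maxStat_le [Nonempty (Fin p)] (hn : 1 ≤ n) {b : ℝ} (hb : 0 < b)
    {ν : Measure (Fin p → ℝ)} [IsProbabilityMeasure ν] (hν : Integrable (fun u => ‖u‖ ^ 3) ν)
    (hν0 : ∀ j, ∫ u, u j ∂ν = 0) (x : Fin n → Fin p → ℝ) :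
    dF ((Measure.pi fun _ : Fin n => centeredEmpirical x).map maxStat)
      ((Measure.pi fun _ : Fin n => ν).map maxStat) ≤ ENNReal.ofReal (bootstrapBound b ν x) := by
  have : IsProbabilityMeasure (centeredEmpirical x) :=
    isProbabilityMeasure_empiricalMeasure hn _
  refine iSup₂_le fun h hh => ENNReal.ofReal_le_ofReal ?_
  have hc := (lipschitzWith_of_mem_testClass hh).continuous
  rw [integral_map measurable_maxStat.aemeasurable hc.aestronglyMeasurable,
    integral_map measurable_maxStat.aemeasurable hc.aestronglyMeasurable]
  refine (integral_maxStat_sub_le (μ := centeredEmpirical x) hh hb hn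
    (integrable_empiricalMeasure hn _ _) hν
    (integral_centeredEmpirical_coord hn x) hν0
    (abs_integral_centeredEmpirical_sub_le hn ν x)).trans ?_
  rw [bootstrapBound]
  gcongr
  exact integral_centeredEmpirical_norm_cube_le hn x

end EmpiricalBound

/-! ### Averaging the bound over the sample -/

section ExpectedBound

variable {n p : ℕ}

theorem integrable_secondMomentDev {ν : Measure (Fin p → ℝ)} [IsProbabilityMeasure ν] {R : ℝ}
    (h4 : Integrable (fun u => ‖u‖ ^ 4) ν) (hR : ∫ u, ‖u‖ ^ 4 ∂ν ≤ R) :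
    Integrable (secondMomentDev ν) ν ∧ Integrable (fun u => ‖secondMomentDev ν u‖ ^ 2) ν ∧
      ∫ u, ‖secondMomentDev ν u‖ ^ 2 ∂ν ≤ 4 * R := by
  have h2 : Integrable (fun u : Fin p → ℝ => ‖u‖ ^ 2) ν :=
    integrable_norm_pow_of_le aestronglyMeasurable_id (by norm_num) h4
  set M := ∫ u, ‖u‖ ^ 2 ∂ν with hM
  -- Next, `M ^ 2 ≤ R` follows by integrating `2 * M * ‖u‖ ^ 2 ≤ ‖u‖ ^ 4 + M ^ 2`.
  have hM0 : 0 ≤ M := integral_nonneg fun _ => by positivity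
  have hM2 : M ^ 2 ≤ R := by
    refine le_trans ?_ hR
    have := integral_mono (μ := ν) (f := fun u : Fin p → ℝ => 2 * M * ‖u‖ ^ 2)
      (g := fun u => ‖u‖ ^ 4 + M ^ 2) (h2.const_mul _) (h4.add (integrable_const _))
      fun u => by
        show 2 * M * ‖u‖ ^ 2 ≤ ‖u‖ ^ 4 + M ^ 2
        nlinarith [sq_nonneg (‖u‖ ^ 2 - M)]
    rw [integral_const_mul, integral_add h4 (integrable_const _)] at this
    simp at this
    nlinarith
  have hmeas : Measurable (secondMomentDev ν) :=
    measurable_pi_lambda _ fun jk => by unfold secondMomentDev; fun_prop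
  have hle : ∀ u, ‖secondMomentDev ν u‖ ≤ ‖u‖ ^ 2 + M := fun u => by
    refine (pi_norm_le_iff_of_nonneg (by positivity)).2 fun jk => ?_
    refine (norm_sub_le _ _).trans (add_le_add ?_ ?_)
    · rw [norm_mul, sq]
      gcongr <;> exact norm_le_pi_norm u _
    · refine norm_integral_le_of_norm_le h2 (Eventually.of_forall fun u => ?_)
      rw [norm_mul, sq]
      gcongr <;> exact norm_le_pi_norm u _
  have hle2 : ∀ u, ‖secondMomentDev ν u‖ ^ 2 ≤ 2 * ‖u‖ ^ 4 + 2 * M ^ 2 := fun u => by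
    refine (pow_le_pow_left₀ (norm_nonneg _) (hle u) 2).trans ?_
    nlinarith [sq_nonneg (‖u‖ ^ 2 - M)]
  have hd : Integrable (fun u : Fin p → ℝ => 2 * ‖u‖ ^ 4 + 2 * M ^ 2) ν :=
    (h4.const_mul 2).add (integrable_const _)
  have hi2 : Integrable (fun u => ‖secondMomentDev ν u‖ ^ 2) ν :=
    hd.mono' (by fun_prop) (Eventually.of_forall fun u => by
      rw [norm_pow, norm_norm]; exact hle2 u)
  refine ⟨(h2.add (integrable_const M)).mono' hmeas.aestronglyMeasurable
    (Eventually.of_forall hle), hi2, ?_⟩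
  refine (integral_mono hi2 hd hle2).trans ?_
  rw [integral_add (h4.const_mul 2) (integrable_const _), integral_const_mul]
  simp
  linarith

theorem integral_secondMomentDev {ν : Measure (Fin p → ℝ)} [IsProbabilityMeasure ν]
    (h2 : Integrable (fun u => ‖u‖ ^ 2) ν) (jk : Fin p × Fin p) :
    ∫ u, secondMomentDev ν u jk ∂ν = 0 := by
  simp only [secondMomentDev]
  rw [integral_sub (integrable_coord_mul h2 _ _) (integrable_const _)]
  simp

/-- The maximal inequality over the `p ^ 2` matrix entries, for the image of `ν` under
`secondMomentDev ν`; the variance term uses the bound `4 * R`. -/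
theorem integral_norm_secondMomentDev_sum_le [Nonempty (Fin p)] {b : ℝ} (hb : 0 < b)
    {ν : Measure (Fin p → ℝ)} [IsProbabilityMeasure ν] {R : ℝ}
    (h4 : Integrable (fun u => ‖u‖ ^ 4) ν) (hR : ∫ u, ‖u‖ ^ 4 ∂ν ≤ R) :
    Integrable (fun x : Fin n → Fin p → ℝ => ‖∑ i, secondMomentDev ν (x i)‖)
        (Measure.pi fun _ => ν) ∧
      ∫ x : Fin n → Fin p → ℝ, ‖∑ i, secondMomentDev ν (x i)‖ ∂(Measure.pi fun _ => ν) ≤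
        Real.log (2 * p ^ 2) / b + n * (8 * b * R) := by
  obtain ⟨i1, i2, i3⟩ := integrable_secondMomentDev h4 hR
  have h2 : Integrable (fun u : Fin p → ℝ => ‖u‖ ^ 2) ν :=
    integrable_norm_pow_of_le aestronglyMeasurable_id (by norm_num) h4
  have hm : Measurable (secondMomentDev ν) :=
    measurable_pi_lambda _ fun jk => by unfold secondMomentDev; fun_prop
  have : IsProbabilityMeasure (ν.map (secondMomentDev ν)) :=
    Measure.isProbabilityMeasure_map hm.aemeasurable
  have hid : Integrable id (ν.map (secondMomentDev ν)) :=
    (integrable_map_measure aestronglyMeasurable_id hm.aemeasurable).2 i1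
  have key := integral_norm_sum_le hb hid
    ((integrable_map_measure (by fun_prop) hm.aemeasurable).2 i2)
    (fun jk => by
      rw [integral_map hm.aemeasurable (measurable_pi_apply jk).aestronglyMeasurable]
      exact integral_secondMomentDev h2 jk) n
  have hint := (integrable_sum_pi (n := n) hid).norm
  have hmm : Measurable fun (x : Fin n → Fin p → ℝ) i => secondMomentDev ν (x i) :=
    measurable_pi_lambda _ fun i => hm.comp (measurable_pi_apply i)
  rw [← Measure.pi_map_pi (fun _ => hm.aemeasurable)] at key hint
  rw [integral_map hm.aemeasurable (by fun_prop), integral_map hmm.aemeasurable (by fun_prop),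
    Fintype.card_prod, Fintype.card_fin] at key
  refine ⟨hint.comp_measurable hmm, key.trans ?_⟩
  push_cast
  rw [← sq]
  have : n * (2 * b * ∫ u, ‖secondMomentDev ν u‖ ^ 2 ∂ν) ≤ n * (2 * b * (4 * R)) := by gcongr
  linarith

/-- The maximal inequality controls only a first moment of the norm, while the covariance error
needs the square of the sample mean. Truncating at level `κ` leaves a linear part for that
inequality and a quartic part for the fourth moment. -/
theorem sq_le_mul_add_pow_four_div {D κ : ℝ} (hκ : 0 < κ) (hD : 0 ≤ D) :
    D ^ 2 ≤ κ * D + D ^ 4 / κ ^ 2 := by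
  rcases le_total D κ with h | h
  · have : 0 ≤ D ^ 4 / κ ^ 2 := by positivity
    nlinarith
  · have : D ^ 2 ≤ D ^ 4 / κ ^ 2 := by
      rw [le_div_iff₀ (by positivity)]
      calc D ^ 2 * κ ^ 2 ≤ D ^ 2 * D ^ 2 := by gcongr
        _ = D ^ 4 := by ring
    nlinarith [mul_nonneg hκ.le hD]

theorem integral_mean_norm_pow {ν : Measure (Fin p → ℝ)} [IsProbabilityMeasure ν] (hn : 1 ≤ n)
    {k : ℕ} (hk : Integrable (fun u => ‖u‖ ^ k) ν) :
    Integrable (fun x : Fin n → Fin p → ℝ => (n : ℝ)⁻¹ * ∑ i, ‖x i‖ ^ k)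
        (Measure.pi fun _ => ν) ∧
      ∫ x : Fin n → Fin p → ℝ, (n : ℝ)⁻¹ * ∑ i, ‖x i‖ ^ k ∂(Measure.pi fun _ => ν) =
        ∫ u, ‖u‖ ^ k ∂ν := by
  have hn0 : (n : ℝ) ≠ 0 := by exact_mod_cast (by omega : n ≠ 0)
  have hi : ∀ i : Fin n, Integrable (fun x : Fin n → Fin p → ℝ => ‖x i‖ ^ k)
      (Measure.pi fun _ => ν) := fun i => integrable_comp_eval (μ := fun _ : Fin n => ν) hk
  refine ⟨(integrable_finsetSum _ fun i _ => hi i).const_mul _, ?_⟩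
  rw [integral_const_mul, integral_finsetSum _ fun i _ => hi i]
  have : ∀ i : Fin n, ∫ x : Fin n → Fin p → ℝ, ‖x i‖ ^ k ∂(Measure.pi fun _ => ν) =
      ∫ u, ‖u‖ ^ k ∂ν := fun i => integral_comp_eval (μ := fun _ : Fin n => ν) hk.1
  simp [this, hn0]

theorem integral_norm_sampleMean_sq_le [Nonempty (Fin p)] (hn : 1 ≤ n) {b κ : ℝ} (hb : 0 < b)
    (hκ : 0 < κ) {ν : Measure (Fin p → ℝ)} [IsProbabilityMeasure ν] {R : ℝ}
    (h4 : Integrable (fun u => ‖u‖ ^ 4) ν) (hR : ∫ u, ‖u‖ ^ 4 ∂ν ≤ R)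
    (h0 : ∀ j, ∫ u, u j ∂ν = 0) :
    Integrable (fun x : Fin n → Fin p → ℝ => ‖sampleMean x‖ ^ 2) (Measure.pi fun _ => ν) ∧
      ∫ x : Fin n → Fin p → ℝ, ‖sampleMean x‖ ^ 2 ∂(Measure.pi fun _ => ν) ≤
        κ * ((n : ℝ)⁻¹ * (Real.log (2 * p) / b + n * (2 * b * (1 + R)))) + R / κ ^ 2 := by
  have h2 : Integrable (fun u : Fin p → ℝ => ‖u‖ ^ 2) ν :=
    integrable_norm_pow_of_le aestronglyMeasurable_id (by norm_num) h4
  have h1 : Integrable (id : (Fin p → ℝ) → _) ν := by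
    refine (integrable_norm_iff aestronglyMeasurable_id).1 ?_
    simpa using integrable_norm_pow_of_le (k := 1)
      (aestronglyMeasurable_id (α := Fin p → ℝ)) (by norm_num) h4
  have hM2 : ∫ u, ‖u‖ ^ 2 ∂ν ≤ 1 + R := by
    have := integral_mono (μ := ν) (f := fun u : Fin p → ℝ => ‖u‖ ^ 2)
      (g := fun u => 1 + ‖u‖ ^ 4) h2 ((integrable_const _).add h4)
      fun u => by
        show ‖u‖ ^ 2 ≤ 1 + ‖u‖ ^ 4
        nlinarith [sq_nonneg (‖u‖ ^ 2 - 1)]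
    rw [integral_add (integrable_const _) h4] at this
    simp at this
    linarith
  obtain ⟨m1, m2⟩ := integral_mean_norm_pow hn h4
  have hs := (integrable_sum_pi (n := n) h1).norm.const_mul (n : ℝ)⁻¹
  have hse : ∀ x : Fin n → Fin p → ℝ, (n : ℝ)⁻¹ * ‖∑ i, x i‖ = ‖sampleMean x‖ := fun x => by
    rw [sampleMean_eq_smul, norm_smul, norm_inv, RCLike.norm_natCast]
  have hbound : ∀ x : Fin n → Fin p → ℝ, ‖sampleMean x‖ ^ 2 ≤
      κ * ((n : ℝ)⁻¹ * ‖∑ i, x i‖) + ((n : ℝ)⁻¹ * ∑ i, ‖x i‖ ^ 4) / κ ^ 2 := fun x => by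
    rw [hse]
    refine (sq_le_mul_add_pow_four_div hκ (norm_nonneg _)).trans ?_
    gcongr
    exact norm_sampleMean_pow_le hn x 4
  have hd : Integrable (fun x : Fin n → Fin p → ℝ =>
      κ * ((n : ℝ)⁻¹ * ‖∑ i, x i‖) + ((n : ℝ)⁻¹ * ∑ i, ‖x i‖ ^ 4) / κ ^ 2)
      (Measure.pi fun _ => ν) := (hs.const_mul κ).add (m1.div_const _)
  have hmeas : Measurable (fun x : Fin n → Fin p → ℝ => sampleMean x) :=
    measurable_pi_lambda _ fun j => by unfold sampleMean; fun_prop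
  have hi : Integrable (fun x : Fin n → Fin p → ℝ => ‖sampleMean x‖ ^ 2)
      (Measure.pi fun _ => ν) := hd.mono' (by fun_prop) (Eventually.of_forall fun x => by
        rw [norm_pow, norm_norm]; exact hbound x)
  refine ⟨hi, (integral_mono hi hd hbound).trans ?_⟩
  rw [integral_add (hs.const_mul κ) (m1.div_const _), integral_div, m2, integral_const_mul,
    integral_const_mul]
  have key := integral_norm_sum_le hb h1 h2 h0 n
  rw [Fintype.card_fin] at key
  gcongr
  exact key.trans (by gcongr)

/-- The expectation of the bound, in terms of a bound `R` on the fourth moment. -/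
theorem integral_bootstrapBound_le [Nonempty (Fin p)] (hn : 1 ≤ n) {b b₁ b₂ κ : ℝ} (hb : 0 < b)
    (hb₁ : 0 < b₁) (hb₂ : 0 < b₂) (hκ : 0 < κ) {ν : Measure (Fin p → ℝ)}
    [IsProbabilityMeasure ν] {R : ℝ} (h4 : Integrable (fun u => ‖u‖ ^ 4) ν)
    (hR : ∫ u, ‖u‖ ^ 4 ∂ν ≤ R) (h0 : ∀ j, ∫ u, u j ∂ν = 0) :
    Integrable (fun x : Fin n → Fin p → ℝ => bootstrapBound b ν x) (Measure.pi fun _ => ν) ∧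
      ∫ x : Fin n → Fin p → ℝ, bootstrapBound b ν x ∂(Measure.pi fun _ => ν) ≤
        2 * (Real.log p / b) + (1 + 2 * b) / 2 *
          ((n : ℝ)⁻¹ * (Real.log (2 * p ^ 2) / b₁ + n * (8 * b₁ * R)) +
            (κ * ((n : ℝ)⁻¹ * (Real.log (2 * p) / b₂ + n * (2 * b₂ * (1 + R)))) + R / κ ^ 2)) +
        (1 + 6 * b + 6 * b ^ 2) * (√(n : ℝ))⁻¹ * (9 * (1 + R)) := by
  have h3 : Integrable (fun u : Fin p → ℝ => ‖u‖ ^ 3) ν :=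
    integrable_norm_pow_of_le aestronglyMeasurable_id (by norm_num) h4
  have hM3 : ∫ u, ‖u‖ ^ 3 ∂ν ≤ 1 + R := by
    have := integral_mono (μ := ν) (f := fun u : Fin p → ℝ => ‖u‖ ^ 3)
      (g := fun u => 1 + ‖u‖ ^ 4) h3 ((integrable_const _).add h4)
      fun u => by
        show ‖u‖ ^ 3 ≤ 1 + ‖u‖ ^ 4
        rcases le_total ‖u‖ 1 with h | h
        · exact (pow_le_one₀ (norm_nonneg _) h).trans (le_add_of_nonneg_right (by positivity))
        · exact (pow_le_pow_right₀ h (by norm_num)).trans (le_add_of_nonneg_left zero_le_one)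
    rw [integral_add (integrable_const _) h4] at this
    simp at this
    linarith
  obtain ⟨c1, c2⟩ := integral_norm_secondMomentDev_sum_le (n := n) hb₁ h4 hR
  obtain ⟨s1, s2⟩ := integral_norm_sampleMean_sq_le hn hb₂ hκ h4 hR h0
  obtain ⟨m1, m2⟩ := integral_mean_norm_pow hn h3
  have e2 := ((c1.const_mul (n : ℝ)⁻¹).add s1).const_mul ((1 + 2 * b) / 2)
  have e3 := ((m1.const_mul 8).add (integrable_const (∫ u, ‖u‖ ^ 3 ∂ν))).const_mul
    ((1 + 6 * b + 6 * b ^ 2) * (√(n : ℝ))⁻¹)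
  have e12 := (integrable_const (μ := Measure.pi fun _ : Fin n => ν)
    (2 * (Real.log p / b))).add e2
  refine ⟨e12.add e3, ?_⟩
  have f2 : ∫ x : Fin n → Fin p → ℝ, (1 + 2 * b) / 2 *
      ((n : ℝ)⁻¹ * ‖∑ i, secondMomentDev ν (x i)‖ + ‖sampleMean x‖ ^ 2) ∂(Measure.pi fun _ => ν) ≤
      (1 + 2 * b) / 2 *
          ((n : ℝ)⁻¹ * (Real.log (2 * p ^ 2) / b₁ + n * (8 * b₁ * R)) +
            (κ * ((n : ℝ)⁻¹ * (Real.log (2 * p) / b₂ + n * (2 * b₂ * (1 + R)))) + R / κ ^ 2)) := by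
    rw [integral_const_mul, integral_add (c1.const_mul _) s1, integral_const_mul]
    gcongr
  have f3 : ∫ x : Fin n → Fin p → ℝ, (1 + 6 * b + 6 * b ^ 2) * (√(n : ℝ))⁻¹ *
      (8 * ((n : ℝ)⁻¹ * ∑ i, ‖x i‖ ^ 3) + ∫ u, ‖u‖ ^ 3 ∂ν) ∂(Measure.pi fun _ => ν) ≤
      (1 + 6 * b + 6 * b ^ 2) * (√(n : ℝ))⁻¹ * (9 * (1 + R)) := by
    rw [integral_const_mul, integral_add (m1.const_mul 8) (integrable_const _),
      integral_const_mul, m2]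
    simp only [integral_const, probReal_univ, one_smul]
    gcongr
    linarith
  refine (integral_add e12 e3).le.trans (add_le_add ?_ f3)
  refine (integral_add (integrable_const _) e2).le.trans (add_le_add ?_ f2)
  simp

end ExpectedBound

/-! ### Measurability of the random distance -/

section Measurability

theorem sub_const_mem_testClass {h : ℝ → ℝ} (hh : h ∈ testClass) (c : ℝ) :
    (fun x => h x - c) ∈ testClass := by
  refine ⟨hh.1.sub contDiff_const, fun i h1 h3 x => ?_⟩
  have : iteratedDeriv i (fun x => h x - c) = iteratedDeriv i h := by
    obtain ⟨k, rfl⟩ : ∃ k, i = k + 1 := ⟨i - 1, by omega⟩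
    rw [iteratedDeriv_succ', iteratedDeriv_succ']
    congr 1
    ext y
    simp
  rw [this]
  exact hh.2 i h1 h3 x

/-- The supremum defining `dF` may be taken over a countable subclass. -/
theorem exists_countable_dF_eq : ∃ D : Set (ℝ → ℝ), D.Countable ∧ D ⊆ testClass ∧
    ∀ μ ν : Measure ℝ, IsProbabilityMeasure μ → IsProbabilityMeasure ν → Integrable id μ →
      Integrable id ν → dF μ ν = ⨆ h ∈ D, ENNReal.ofReal (∫ x, h x ∂μ - ∫ x, h x ∂ν) := by
  -- Constants cancel between probability measures, so `f 0 = 0` may be imposed. Separability is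
  -- that of the compact-open topology, which still gives pointwise convergence.
  let S : Set C(ℝ, ℝ) := {f | ⇑f ∈ testClass ∧ f 0 = 0}
  obtain ⟨t, htc, htd⟩ := TopologicalSpace.exists_countable_dense S
  have hsub : (fun f : S => (⇑f.1 : ℝ → ℝ)) '' t ⊆ testClass := by
    rintro _ ⟨f, -, rfl⟩
    exact f.2.1
  refine ⟨(fun f : S => (⇑f.1 : ℝ → ℝ)) '' t, htc.image _, hsub, fun μ ν _ _ hμ hν => ?_⟩
  refine le_antisymm (iSup₂_le fun h hh => ?_)
    (iSup₂_le fun h hh => le_iSup₂ (f := fun h (_ : h ∈ testClass) =>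
      ENNReal.ofReal (∫ x, h x ∂μ - ∫ x, h x ∂ν)) h (hsub hh))
  let f : S := ⟨⟨fun x => h x - h 0, by
    have := (lipschitzWith_of_mem_testClass hh).continuous
    fun_prop⟩, sub_const_mem_testClass hh (h 0), by simp⟩
  obtain ⟨g, hgt, hg⟩ := mem_closure_iff_seq_limit.1 (htd f)
  have hpt : ∀ x, Tendsto (fun k => (g k).1 x) atTop (𝓝 (h x - h 0)) := fun x =>
    ((continuous_eval_const (F := C(ℝ, ℝ)) x).comp continuous_subtype_val).continuousAt.tendsto.comp
      hg
  have hlim : ∀ ρ : Measure ℝ, IsProbabilityMeasure ρ → Integrable id ρ →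
      Tendsto (fun k => ∫ x, (g k).1 x ∂ρ) atTop (𝓝 (∫ x, h x ∂ρ - h 0)) := fun ρ _ hρ => by
    have : ∫ x, h x ∂ρ - h 0 = ∫ x, (h x - h 0) ∂ρ := by
      have hi : Integrable h ρ :=
        integrable_lipschitz_comp (lipschitzWith_of_mem_testClass hh) hρ
      rw [integral_sub hi (integrable_const _)]
      simp
    rw [this]
    -- The normalization at zero and the Lipschitz constant one give the common dominating function
    -- `‖x‖`.
    refine tendsto_integral_of_dominated_convergence (fun x => ‖x‖)
      (fun k => (g k).1.continuous.aestronglyMeasurable) hρ.norm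
      (fun k => Eventually.of_forall fun x => ?_) (Eventually.of_forall hpt)
    have := (lipschitzWith_of_mem_testClass (g k).2.1).dist_le_mul x 0
    rw [(g k).2.2] at this
    simpa using this
  have hfin : Tendsto (fun k => ENNReal.ofReal (∫ x, (g k).1 x ∂μ - ∫ x, (g k).1 x ∂ν)) atTop
      (𝓝 (ENNReal.ofReal (∫ x, h x ∂μ - ∫ x, h x ∂ν))) := by
    refine (ENNReal.continuous_ofReal.tendsto _).comp ?_
    have := (hlim μ ‹_› hμ).sub (hlim ν ‹_› hν)
    simpa using this
  exact le_of_tendsto' hfin fun k => le_iSup₂ (f := fun (h : ℝ → ℝ)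
    (_ : h ∈ (fun f : S => (⇑f.1 : ℝ → ℝ)) '' t) =>
      ENNReal.ofReal (∫ x, h x ∂μ - ∫ x, h x ∂ν)) _ ⟨g k, hgt k, rfl⟩

/-- The reduction to a countable class requires finite first moments, which the conditional laws
have only almost surely; hence `AEMeasurable`. -/
theorem aemeasurable_dFCond {Ω E : Type*} [MeasurableSpace Ω] [MeasurableSpace E]
    {P : Measure Ω} [IsFiniteMeasure P] {U V : Ω → ℝ} {W : Ω → E} (hW : Measurable W)
    (hU : ∀ᵐ x ∂(P.map W), Integrable id (condDistrib U W P x))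
    (hV : ∀ᵐ x ∂(P.map W), Integrable id (condDistrib V W P x)) :
    AEMeasurable (dFCond P U V W) P := by
  obtain ⟨D, hDc, hD, hdF⟩ := exists_countable_dF_eq
  have hint : ∀ (U : Ω → ℝ), ∀ h ∈ D, Measurable fun ω => ∫ x, h x ∂(condDistrib U W P (W ω)) :=
    fun U h hh => (StronglyMeasurable.integral_condDistrib (f := fun y : E × ℝ => h y.2)
      ((lipschitzWith_of_mem_testClass (hD hh)).continuous.stronglyMeasurable.comp_measurable
        measurable_snd)).measurable.comp hW
  refine ⟨fun ω => ⨆ h ∈ D, ENNReal.ofReal (∫ x, h x ∂(condDistrib U W P (W ω)) -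
    ∫ x, h x ∂(condDistrib V W P (W ω))), Measurable.biSup D hDc fun h hh =>
      ((hint U h hh).sub (hint V h hh)).ennreal_ofReal, ?_⟩
  filter_upwards [ae_of_ae_map hW.aemeasurable hU, ae_of_ae_map hW.aemeasurable hV] with ω h1 h2
  exact hdF _ _ inferInstance inferInstance h1 h2

end Measurability

/-! ### Computing conditional laws -/

section ConditionalLaw

variable {Ω E F G : Type*} [MeasurableSpace Ω] [MeasurableSpace E] [MeasurableSpace F]
  [MeasurableSpace G] [StandardBorelSpace F] [Nonempty F] [StandardBorelSpace G] [Nonempty G]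
  {P : Measure Ω} [IsProbabilityMeasure P]

theorem condDistrib_of_indepFun {X : Ω → E} {Y : Ω → F} (hX : Measurable X) (hY : Measurable Y)
    (h : IndepFun X Y P) : ∀ᵐ x ∂(P.map X), condDistrib Y X P x = P.map Y := by
  have : IsProbabilityMeasure (P.map Y) := Measure.isProbabilityMeasure_map hY.aemeasurable
  have key := (condDistrib_ae_eq_iff_measure_eq_compProd (μ := P) X hY.aemeasurable
    (Kernel.const E (P.map Y))).2 (by
      rw [Measure.compProd_const,
        (indepFun_iff_map_prod_eq_prod_map_map hX.aemeasurable hY.aemeasurable).1 h])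
  filter_upwards [key] with x hx
  rw [hx, Kernel.const_apply]

/-- Conditionally on `X = x` the first argument of `g` is frozen. The proof checks that the
pushed-forward kernel disintegrates the joint law of `X` and `g X Z`, then uses uniqueness. -/
theorem condDistrib_comp_prodMk {X : Ω → E} {Z : Ω → F} (hX : Measurable X) (hZ : Measurable Z)
    {g : E → F → G} (hg : Measurable fun a : E × F => g a.1 a.2) :
    ∀ᵐ x ∂(P.map X), condDistrib (fun ω => g (X ω) (Z ω)) X P x =
      (condDistrib Z X P x).map (g x) := by
  have hgx : ∀ x, Measurable (g x) := fun x => hg.comp (measurable_const.prodMk measurable_id)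
  have happ : ∀ x, ((Kernel.id ×ₖ condDistrib Z X P).map (fun a : E × F => g a.1 a.2)) x =
      (condDistrib Z X P x).map (g x) := fun x => by
    rw [Kernel.map_apply _ hg, Kernel.prod_apply, Kernel.id_apply, Measure.dirac_prod,
      Measure.map_map hg (by fun_prop)]
    rfl
  have : IsMarkovKernel ((Kernel.id ×ₖ condDistrib Z X P).map (fun a : E × F => g a.1 a.2)) :=
    Kernel.IsMarkovKernel.map _ hg
  have key := (condDistrib_ae_eq_iff_measure_eq_compProd (μ := P) X
    (Y := fun ω => g (X ω) (Z ω)) (hg.comp (hX.prodMk hZ)).aemeasurable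
    ((Kernel.id ×ₖ condDistrib Z X P).map (fun a : E × F => g a.1 a.2))).2 (by
      have hm : Measurable fun a : E × F => (a.1, g a.1 a.2) := measurable_fst.prodMk hg
      have e : P.map (fun ω => (X ω, g (X ω) (Z ω))) =
          (P.map fun ω => (X ω, Z ω)).map fun a : E × F => (a.1, g a.1 a.2) := by
        rw [Measure.map_map hm (hX.prodMk hZ)]
        rfl
      rw [e, ← compProd_map_condDistrib hZ.aemeasurable]
      ext s hs
      rw [Measure.map_apply hm hs, Measure.compProd_apply (hm hs), Measure.compProd_apply hs]
      refine lintegral_congr fun x => ?_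
      rw [happ, Measure.map_apply (hgx x) (measurable_prodMk_left hs)]
      rfl)
  filter_upwards [key] with x hx
  rw [hx, happ]

end ConditionalLaw

/-! ### Conditional laws of the two statistics -/

section BootstrapLaws

theorem IsIIDSample.map_eq {Ω E : Type*} [MeasurableSpace Ω] [MeasurableSpace E] {n : ℕ}
    {X : Ω → Fin n → E} {ν : Measure E} {P : Measure Ω} [IsProbabilityMeasure P]
    (hX : IsIIDSample X ν P) :
    P.map X = Measure.pi fun _ => ν := by
  have := hX.2.1.map_fun_eq_pi_map (fun i => (hX.2.2 i).aemeasurable)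
  simpa only [(hX.2.2 _).map_eq] using this

theorem bootstrapBound_nonneg {n p : ℕ} {b : ℝ} (hb : 0 < b)
    (ν : Measure (Fin p → ℝ)) (x : Fin n → Fin p → ℝ) :
    0 ≤ bootstrapBound b ν x := by
  have : 0 ≤ Real.log p := Real.log_natCast_nonneg p
  have h3 : 0 ≤ ∫ u, ‖u‖ ^ 3 ∂ν := integral_nonneg fun _ => by positivity
  unfold bootstrapBound
  positivity

variable {Ω : Type*} [MeasurableSpace Ω] {P : Measure Ω} [IsProbabilityMeasure P] {n p : ℕ}
  {ν : Measure (Fin p → ℝ)} [IsProbabilityMeasure ν] {X Y Z : Ω → Fin n → Fin p → ℝ}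

/-- The centered law. -/
def centeredLaw (ν : Measure (Fin p → ℝ)) : Measure (Fin p → ℝ) := ν.map fun x => x - meanVec ν

instance : IsProbabilityMeasure (centeredLaw ν) :=
  Measure.isProbabilityMeasure_map (by fun_prop)

theorem pi_map_centered : (Measure.pi fun _ : Fin n => ν).map (fun y i => y i - meanVec ν) =
    Measure.pi fun _ : Fin n => centeredLaw ν :=
  Measure.pi_map_pi (f := fun _ x => x - meanVec ν) fun _ => by fun_prop

theorem ae_condDistrib_centered (hX : IsIIDSample X ν P) (hY : IsIndependentCopy Y X P) :
    ∀ᵐ x ∂(P.map X), condDistrib (fun ω => maxStat (fun i => Y ω i - meanVec ν)) X P x =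
      (Measure.pi fun _ : Fin n => centeredLaw ν).map maxStat := by
  have hc : Measurable fun (y : Fin n → Fin p → ℝ) i => y i - meanVec ν := by fun_prop
  have hm : Measurable fun y : Fin n → Fin p → ℝ => maxStat (fun i => y i - meanVec ν) :=
    measurable_maxStat.comp hc
  have key := condDistrib_of_indepFun hX.1 (hm.comp hY.1) (hY.2.1.comp measurable_id hm)
  filter_upwards [key] with x hx
  refine hx.trans ?_
  rw [← Measure.map_map hm hY.1, hY.2.2.map_eq, hX.map_eq, ← pi_map_centered,
    Measure.map_map measurable_maxStat hc]
  rfl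

theorem ae_condDistrib_bootstrap (hn : 1 ≤ n) (hX : Measurable X)
    (hZ : IsBootstrapSample Z X P) :
    ∀ᵐ x ∂(P.map X), condDistrib (fun ω => maxStat (fun i => Z ω i - sampleMean (X ω))) X P x =
      (Measure.pi fun _ : Fin n => centeredEmpirical x).map maxStat := by
  have hs : Measurable (sampleMean : (Fin n → Fin p → ℝ) → _) := by
    unfold sampleMean; fun_prop
  have hg : Measurable fun a : (Fin n → Fin p → ℝ) × (Fin n → Fin p → ℝ) =>
      maxStat (fun i => a.2 i - sampleMean a.1) :=
    measurable_maxStat.comp (measurable_pi_lambda _ fun i => by fun_prop)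
  filter_upwards [hZ.2, condDistrib_comp_prodMk hX hZ.1
    (g := fun x z : Fin n → Fin p → ℝ => maxStat (fun i => z i - sampleMean x)) hg] with x h1 h2
  have := isProbabilityMeasure_empiricalMeasure hn x
  have hc : Measurable fun z : Fin p → ℝ => z - sampleMean x := by fun_prop
  have e : (Measure.pi fun _ : Fin n => centeredEmpirical x) =
      (Measure.pi fun _ : Fin n => empiricalMeasure x).map (fun z i => z i - sampleMean x) := by
    have : IsProbabilityMeasure ((empiricalMeasure x).map fun z => z - sampleMean x) :=
      Measure.isProbabilityMeasure_map hc.aemeasurable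
    rw [Measure.pi_map_pi (f := fun _ z => z - sampleMean x) fun _ => hc.aemeasurable,
      map_empiricalMeasure hc]
    rfl
  rw [h2, h1, e, Measure.map_map measurable_maxStat (by fun_prop)]
  rfl

theorem integrable_id_map_maxStat [Nonempty (Fin p)] (hν : Integrable id ν) :
    Integrable id ((Measure.pi fun _ : Fin n => ν).map maxStat) :=
  (integrable_map_measure aestronglyMeasurable_id measurable_maxStat.aemeasurable).2
    (integrable_maxStat hν)

theorem integrable_centeredLaw (hν : Integrable id ν) : Integrable id (centeredLaw ν) :=
  (integrable_map_measure aestronglyMeasurable_id (by fun_prop)).2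
    (hν.sub (integrable_const _))

theorem integral_centeredLaw_coord (hν : Integrable id ν) (j : Fin p) :
    ∫ u, u j ∂(centeredLaw ν) = 0 := by
  rw [centeredLaw, integral_map (by fun_prop) (f := fun u : Fin p → ℝ => u j)
    (measurable_pi_apply j).aestronglyMeasurable]
  simp only [Pi.sub_apply]
  have hj : Integrable (fun u : Fin p → ℝ => u j) ν := hν.eval j
  rw [integral_sub hj (integrable_const _)]
  simp [meanVec]

theorem aemeasurable_dFCond_bootstrap [Nonempty (Fin p)] (hν : Integrable id ν)
    (hX : IsIIDSample X ν P) (hY : IsIndependentCopy Y X P) (hZ : IsBootstrapSample Z X P) :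
    AEMeasurable (dFCond P (fun ω => maxStat (fun i => Z ω i - sampleMean (X ω)))
      (fun ω => maxStat (fun i => Y ω i - meanVec ν)) X) P := by
  have hV : ∀ᵐ x ∂(P.map X), Integrable id
      (condDistrib (fun ω => maxStat (fun i => Y ω i - meanVec ν)) X P x) := by
    filter_upwards [ae_condDistrib_centered hX hY] with x hx
    rw [hx]
    exact integrable_id_map_maxStat (integrable_centeredLaw hν)
  refine aemeasurable_dFCond hX.1 ?_ hV
  rcases Nat.eq_zero_or_pos n with rfl | hn
  -- For `n = 0` the empirical measure is not a probability measure, but samples indexed by `Fin 0`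
  -- are all equal, so both statistics coincide.
  · have e : (fun ω => maxStat (fun i => Z ω i - sampleMean (X ω))) =
        fun ω => maxStat (fun i => Y ω i - meanVec ν) := by
      ext ω
      exact congrArg maxStat (Subsingleton.elim _ _)
    rw [e]
    exact hV
  · filter_upwards [ae_condDistrib_bootstrap hn hX.1 hZ] with x hx
    rw [hx]
    have : IsProbabilityMeasure (centeredEmpirical x) :=
      isProbabilityMeasure_empiricalMeasure hn _
    exact integrable_id_map_maxStat (integrable_empiricalMeasure hn _ _)

theorem lintegral_dFCond_bootstrap_le (hp : 1 ≤ p) (hn : 1 ≤ n) {b : ℝ} (hb : 0 < b)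
    (hν : Integrable (fun u => ‖u‖ ^ 3) (centeredLaw ν)) (hν1 : Integrable id ν)
    (hb' : Integrable (fun x : Fin n → Fin p → ℝ => bootstrapBound b (centeredLaw ν) x)
      (Measure.pi fun _ => centeredLaw ν))
    (hX : IsIIDSample X ν P) (hY : IsIndependentCopy Y X P) (hZ : IsBootstrapSample Z X P) :
    ∫⁻ ω, dFCond P (fun ω => maxStat (fun i => Z ω i - sampleMean (X ω)))
      (fun ω => maxStat (fun i => Y ω i - meanVec ν)) X ω ∂P ≤
    ENNReal.ofReal (∫ x : Fin n → Fin p → ℝ, bootstrapBound b (centeredLaw ν) x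
      ∂(Measure.pi fun _ => centeredLaw ν)) := by
  have : Nonempty (Fin p) := ⟨⟨0, hp⟩⟩
  have hc : Measurable fun (y : Fin n → Fin p → ℝ) i => y i - meanVec ν := by fun_prop
  calc _ ≤ ∫⁻ ω, ENNReal.ofReal (bootstrapBound b (centeredLaw ν)
          (fun i => X ω i - meanVec ν)) ∂P := by
        refine lintegral_mono_ae ?_
        filter_upwards [ae_of_ae_map hX.1.aemeasurable (ae_condDistrib_bootstrap hn hX.1 hZ),
          ae_of_ae_map hX.1.aemeasurable (ae_condDistrib_centered hX hY)] with ω h1 h2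
        -- Recentering the sample at the true mean makes its law the product of copies of
        -- `centeredLaw ν`, over which the bound is averaged.
        rw [dFCond, h1, h2, ← centeredEmpirical_sub_const hn (X ω) (meanVec ν)]
        exact dF_map_maxStat_le hn hb hν (integral_centeredLaw_coord hν1) _
    _ = ∫⁻ x, ENNReal.ofReal (bootstrapBound b (centeredLaw ν) x)
          ∂(Measure.pi fun _ : Fin n => centeredLaw ν) := by
        have e : (Measure.pi fun _ : Fin n => centeredLaw ν) =
            P.map (fun ω i => X ω i - meanVec ν) := by
          rw [← pi_map_centered, ← hX.map_eq, Measure.map_map hc hX.1]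
          rfl
        rw [e] at hb' ⊢
        rw [lintegral_map' hb'.1.aemeasurable.ennreal_ofReal (hc.comp hX.1).aemeasurable]
    _ = _ := (ofReal_integral_eq_lintegral_ofReal hb'
        (Eventually.of_forall fun x => bootstrapBound_nonneg hb _ x)).symm

end BootstrapLaws

/-! ### From the moment hypothesis to centered fourth moments -/

section Moments

theorem enorm_meanVec_le {p : ℕ} {ν : Measure (Fin p → ℝ)} (hν : Integrable id ν) :
    ‖meanVec ν‖ₑ ≤ eLpNorm id 1 ν := by
  rw [eLpNorm_one_eq_lintegral_enorm, ← ofReal_integral_norm_eq_lintegral_enorm hν,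
    ← ofReal_norm]
  refine ENNReal.ofReal_le_ofReal ((pi_norm_le_iff_of_nonneg
    (integral_nonneg fun _ => norm_nonneg _)).2 fun j => ?_)
  exact norm_integral_le_of_norm_le hν.norm (Eventually.of_forall fun u => norm_le_pi_norm u j)

variable {p : ℕ} {ν : Measure (Fin p → ℝ)} [IsProbabilityMeasure ν]

/-- A twelfth moment of the maximum of the coordinates bounds the centered fourth moment. -/
theorem centeredLaw_moment [Nonempty (Fin p)] {C : ℝ≥0}
    (h : eLpNorm (fun x : Fin p → ℝ => ⨆ k, |x k|) 12 ν ≤ C) :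
    Integrable id ν ∧ Integrable (fun u => ‖u‖ ^ 4) (centeredLaw ν) ∧
      ∫ u, ‖u‖ ^ 4 ∂(centeredLaw ν) ≤ (2 * C) ^ 4 := by
  have hnorm : ∀ x : Fin p → ℝ, ⨆ k, |x k| = ‖x‖ := fun x =>
    le_antisymm (ciSup_le fun k => norm_le_pi_norm x k)
      ((pi_norm_le_iff_of_nonempty _).2 fun k =>
        le_ciSup (f := fun k => |x k|) (Set.finite_range _).bddAbove k)
  simp only [hnorm] at h
  rw [eLpNorm_norm] at h
  have hid : ∀ q : ℝ≥0∞, q ≤ 12 → eLpNorm (id : (Fin p → ℝ) → _) q ν ≤ C := fun q hq =>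
    (eLpNorm_le_eLpNorm_of_exponent_le hq aestronglyMeasurable_id).trans h
  have h1 : Integrable (id : (Fin p → ℝ) → _) ν :=
    memLp_one_iff_integrable.1 ⟨aestronglyMeasurable_id,
      (hid 1 (by norm_num)).trans_lt ENNReal.coe_lt_top⟩
  -- Minkowski: the vector and its mean each contribute at most `C`.
  have h4 : eLpNorm (id : (Fin p → ℝ) → _) 4 (centeredLaw ν) ≤ ENNReal.ofReal (2 * C) := by
    rw [centeredLaw, eLpNorm_map_measure aestronglyMeasurable_id (by fun_prop)]
    refine (eLpNorm_sub_le (f := id) (g := fun _ => meanVec ν) aestronglyMeasurable_id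
      aestronglyMeasurable_const (by norm_num)).trans ?_
    rw [eLpNorm_const _ (by norm_num) (IsProbabilityMeasure.ne_zero ν), measure_univ,
      ENNReal.one_rpow, mul_one, ENNReal.ofReal_mul zero_le_two, ENNReal.ofReal_coe_nnreal]
    calc _ ≤ (C : ℝ≥0∞) + C := add_le_add (hid 4 (by norm_num))
          ((enorm_meanVec_le h1).trans (hid 1 (by norm_num)))
      _ = _ := by rw [← two_mul]; norm_num
  have hm : MemLp (id : (Fin p → ℝ) → _) 4 (centeredLaw ν) :=
    ⟨aestronglyMeasurable_id, h4.trans_lt ENNReal.ofReal_lt_top⟩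
  refine ⟨h1, by simpa using hm.integrable_norm_pow (p := 4) (by norm_num), ?_⟩
  rw [hm.eLpNorm_eq_integral_rpow_norm (by norm_num) (by norm_num),
    ENNReal.ofReal_le_ofReal_iff (by positivity)] at h4
  have h0 : 0 ≤ ∫ u, ‖u‖ ^ 4 ∂(centeredLaw ν) := integral_nonneg fun _ => by positivity
  have e : (4 : ℝ≥0∞).toReal = (4 : ℕ) := by norm_num
  rw [e] at h4
  simp only [Real.rpow_natCast, id] at h4
  have := pow_le_pow_left₀ (by positivity) h4 4
  rwa [Real.rpow_inv_natCast_pow h0 (by norm_num)] at this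

end Moments

/-! ### Choice of parameters and the limit -/

section Asymptotics

/-- The parameters of `integral_bootstrapBound_le` are `b = ε / t ^ 2`, `b₁ = t ^ 2`, `b₂ = t ^ 3`
and `κ = t⁻¹`. They make every part of the covariance error of order `t ^ 2`, which the factor of
order `b` turns into order `ε`. The summand `t` in `ε` keeps `b` positive when `L = 0`. -/
theorem expectedBound_le {t ε R L L₁ L₂ n s : ℝ} (ht : 0 < t) (ht1 : t ≤ 1) (hR : 0 ≤ R)
    (hL : 0 ≤ L) (hε : ε = √(L * t ^ 2) + t) (hn : n⁻¹ = t ^ 8) (hs : s = t ^ 4)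
    (hL₁ : L₁ ≤ 1 / t ^ 2) (hL₂ : L₂ ≤ 1 / t ^ 2) :
    2 * (L / (ε / t ^ 2)) + (1 + 2 * (ε / t ^ 2)) / 2 *
        (n⁻¹ * (L₁ / t ^ 2 + n * (8 * t ^ 2 * R)) +
          (t⁻¹ * (n⁻¹ * (L₂ / t ^ 3 + n * (2 * t ^ 3 * (1 + R)))) + R / t⁻¹ ^ 2)) +
      (1 + 6 * (ε / t ^ 2) + 6 * (ε / t ^ 2) ^ 2) * s * (9 * (1 + R)) ≤
    2 * √(L * t ^ 2) + (t ^ 2 + 2 * ε) / 2 * (4 + 11 * R) +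
      (t ^ 4 + 6 * ε * t ^ 2 + 6 * ε ^ 2) * (9 * (1 + R)) := by
  have hq0 : 0 ≤ √(L * t ^ 2) := Real.sqrt_nonneg _
  have hε0 : 0 < ε := by rw [hε]; positivity
  have hn' : n = (t ^ 8)⁻¹ := by rw [← hn, inv_inv]
  have e1 : L / (ε / t ^ 2) ≤ √(L * t ^ 2) := by
    rw [div_div_eq_mul_div, div_le_iff₀ hε0, hε]
    have := Real.mul_self_sqrt (show 0 ≤ L * t ^ 2 by positivity)
    nlinarith
  have b1 : t ^ 8 * (L₁ / t ^ 2) ≤ t ^ 2 := by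
    calc t ^ 8 * (L₁ / t ^ 2) ≤ t ^ 8 * ((1 / t ^ 2) / t ^ 2) := by gcongr
      _ = t ^ 4 := by field_simp
      _ ≤ t ^ 2 := pow_le_pow_of_le_one ht.le ht1 (by norm_num)
  have b2 : t⁻¹ * (t ^ 8 * (L₂ / t ^ 3)) ≤ t ^ 2 := by
    calc t⁻¹ * (t ^ 8 * (L₂ / t ^ 3)) ≤ t⁻¹ * (t ^ 8 * ((1 / t ^ 2) / t ^ 3)) := by gcongr
      _ = t ^ 2 := by field_simp
  have e2 : n⁻¹ * (L₁ / t ^ 2 + n * (8 * t ^ 2 * R)) +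
      (t⁻¹ * (n⁻¹ * (L₂ / t ^ 3 + n * (2 * t ^ 3 * (1 + R)))) + R / t⁻¹ ^ 2) ≤
      t ^ 2 * (4 + 11 * R) := by
    have : n⁻¹ * (L₁ / t ^ 2 + n * (8 * t ^ 2 * R)) +
      (t⁻¹ * (n⁻¹ * (L₂ / t ^ 3 + n * (2 * t ^ 3 * (1 + R)))) + R / t⁻¹ ^ 2) =
      t ^ 8 * (L₁ / t ^ 2) + 8 * t ^ 2 * R + t⁻¹ * (t ^ 8 * (L₂ / t ^ 3)) + 2 * t ^ 2 * (1 + R)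
        + R * t ^ 2 := by
      rw [hn']; field_simp; ring
    rw [this]
    linarith
  have e3 : (1 + 2 * (ε / t ^ 2)) / 2 * (t ^ 2 * (4 + 11 * R)) =
      (t ^ 2 + 2 * ε) / 2 * (4 + 11 * R) := by field_simp
  have e4 : (1 + 6 * (ε / t ^ 2) + 6 * (ε / t ^ 2) ^ 2) * t ^ 4 =
      t ^ 4 + 6 * ε * t ^ 2 + 6 * ε ^ 2 := by field_simp
  rw [hs, e4, ← e3]
  gcongr

theorem tendsto_bound_zero {L t : ℕ → ℝ} (R : ℝ) (hL : Tendsto (fun n => L n * t n ^ 2) atTop (𝓝 0))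
    (ht : Tendsto t atTop (𝓝 0)) :
    Tendsto (fun n => 2 * √(L n * t n ^ 2) +
      (t n ^ 2 + 2 * (√(L n * t n ^ 2) + t n)) / 2 * (4 + 11 * R) +
      (t n ^ 4 + 6 * (√(L n * t n ^ 2) + t n) * t n ^ 2 + 6 * (√(L n * t n ^ 2) + t n) ^ 2) *
        (9 * (1 + R))) atTop (𝓝 0) := by
  have hc : Continuous fun q : ℝ × ℝ => 2 * √q.1 +
      (q.2 ^ 2 + 2 * (√q.1 + q.2)) / 2 * (4 + 11 * R) +
      (q.2 ^ 4 + 6 * (√q.1 + q.2) * q.2 ^ 2 + 6 * (√q.1 + q.2) ^ 2) * (9 * (1 + R)) := by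
    fun_prop
  have := (hc.tendsto (0, 0)).comp (hL.prodMk_nhds ht)
  simpa [Function.comp_def] using this

end Asymptotics

end Bootstrap

end

/-! ### Proof of the theorem -/

theorem mainTheorem9
    (p : ℕ → ℕ) (hp : ∀ n, 1 ≤ p n)
    (hlog : (fun n : ℕ => Real.log (p n)) =o[atTop] (fun n : ℕ => (n : ℝ) ^ (1 / 4 : ℝ)))
    {Ω : ℕ → Type*} [∀ n, MeasurableSpace (Ω n)]
    (P : ∀ n, Measure (Ω n)) [∀ n, IsProbabilityMeasure (P n)]
    (ν : ∀ n, Measure (Fin (p n) → ℝ)) [∀ n, IsProbabilityMeasure (ν n)]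
    (X Y Z : ∀ n, Ω n → Fin n → Fin (p n) → ℝ)
    (hX : ∀ n, Bootstrap.IsIIDSample (X n) (ν n) (P n))
    (hY : ∀ n, Bootstrap.IsIndependentCopy (Y n) (X n) (P n))
    (hZ : ∀ n, Bootstrap.IsBootstrapSample (Z n) (X n) (P n))
    (hmom : ∃ C : ℝ≥0, ∀ n, eLpNorm (fun x : Fin (p n) → ℝ => ⨆ k, |x k|) 12 (ν n) ≤ C) :
    (∀ n, AEMeasurable
      (Bootstrap.dFCond (P n)
        (fun ω => Bootstrap.maxStat (fun i => Z n ω i - Bootstrap.sampleMean (X n ω)))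
        (fun ω => Bootstrap.maxStat (fun i => Y n ω i - Bootstrap.meanVec (ν n)))
        (X n)) (P n)) ∧
    Tendsto
      (fun n => ∫⁻ ω, Bootstrap.dFCond (P n)
        (fun ω => Bootstrap.maxStat (fun i => Z n ω i - Bootstrap.sampleMean (X n ω)))
        (fun ω => Bootstrap.maxStat (fun i => Y n ω i - Bootstrap.meanVec (ν n)))
        (X n) ω ∂(P n))
      atTop (𝓝 0) := by
  obtain ⟨C, hC⟩ := hmom
  have hne : ∀ n, Nonempty (Fin (p n)) := fun n => ⟨⟨0, hp n⟩⟩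
  have hmo := fun n => Bootstrap.centeredLaw_moment (hC n)
  refine ⟨fun n => Bootstrap.aemeasurable_dFCond_bootstrap (hmo n).1 (hX n) (hY n) (hZ n), ?_⟩
  set R : ℝ := (2 * C) ^ 4
  have hR : 0 ≤ R := by positivity
  -- All rates become integer powers of `t`; the growth condition on `p` reads `L n * t n ^ 2 → 0`.
  let t : ℕ → ℝ := fun n => (n : ℝ) ^ (-(1 / 8) : ℝ)
  let L : ℕ → ℝ := fun n => Real.log (p n)
  have hL0 : ∀ n, 0 ≤ L n := fun n => Real.log_natCast_nonneg _
  have ht : Tendsto t atTop (𝓝 0) :=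
    (tendsto_rpow_neg_atTop (by norm_num : (0 : ℝ) < 1 / 8)).comp tendsto_natCast_atTop_atTop
  have htk : ∀ n : ℕ, ∀ k : ℕ, t n ^ k = (n : ℝ) ^ (-(k / 8) : ℝ) := fun n k => by
    simp only [t]
    rw [← Real.rpow_natCast, ← Real.rpow_mul (Nat.cast_nonneg n)]
    congr 1
    ring
  have hLt : Tendsto (fun n => L n * t n ^ 2) atTop (𝓝 0) := by
    refine hlog.tendsto_div_nhds_zero.congr fun n => ?_
    rw [htk, Real.rpow_neg (Nat.cast_nonneg n), div_eq_mul_inv]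
    norm_num [L]
  have hlim := ENNReal.tendsto_ofReal (Bootstrap.tendsto_bound_zero R hLt ht)
  rw [ENNReal.ofReal_zero] at hlim
  refine tendsto_of_tendsto_of_tendsto_of_le_of_le' tendsto_const_nhds hlim
    (Eventually.of_forall fun _ => zero_le) ?_
  -- The thresholds `1 / 4` and `1 / 2` give `(log 2 + 2 * L n) * t n ^ 2 ≤ 1 / 4 + 1 / 2 ≤ 1`,
  -- which is `hL₁`.
  filter_upwards [eventually_ge_atTop 1,
    hLt.eventually (eventually_le_nhds (b := 1 / 4) (by norm_num)),
    ht.eventually (eventually_le_nhds (b := 1 / 2) (by norm_num))] with n hn hLn htn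
  have hn0 : (0 : ℝ) < n := by exact_mod_cast hn
  have hp1 : (1 : ℝ) ≤ p n := by exact_mod_cast hp n
  have htpos : 0 < t n := Real.rpow_pos_of_pos hn0 _
  have hinv : (n : ℝ)⁻¹ = t n ^ 8 := by
    rw [htk, ← Real.rpow_neg_one]; norm_num
  have hsqrt : (√(n : ℝ))⁻¹ = t n ^ 4 := by
    rw [← Real.sqrt_inv, hinv, show t n ^ 8 = (t n ^ 4) ^ 2 by ring, Real.sqrt_sq (by positivity)]
  have hL₁ : Real.log (2 * p n ^ 2) ≤ 1 / t n ^ 2 := by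
    rw [le_div_iff₀ (by positivity), Real.log_mul (by norm_num) (by positivity), Real.log_pow]
    have h2 := Real.log_two_lt_d9
    have : t n ^ 2 ≤ 1 / 4 := by nlinarith
    have h3 : Real.log 2 * t n ^ 2 ≤ 1 * t n ^ 2 := by
      gcongr
      linarith
    simp only [L] at hLn
    push_cast
    linarith
  have hL₂ : Real.log (2 * p n) ≤ 1 / t n ^ 2 := by
    refine (Real.log_le_log (by positivity) ?_).trans hL₁
    nlinarith
  have hε : 0 < √(L n * t n ^ 2) + t n := by positivity
  have hb : 0 < (√(L n * t n ^ 2) + t n) / t n ^ 2 := by positivity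
  obtain ⟨h1, h4, h4R⟩ := hmo n
  obtain ⟨i1, i2⟩ := Bootstrap.integral_bootstrapBound_le hn hb (pow_pos htpos 2) (pow_pos htpos 3)
    (inv_pos.2 htpos) h4 h4R (Bootstrap.integral_centeredLaw_coord h1)
  refine (Bootstrap.lintegral_dFCond_bootstrap_le (hp n) hn hb
    (Bootstrap.integrable_norm_pow_of_le aestronglyMeasurable_id (by norm_num) h4) h1 i1
    (hX n) (hY n) (hZ n)).trans (ENNReal.ofReal_le_ofReal (i2.trans ?_))
  exact Bootstrap.expectedBound_le htpos (by linarith) hR (hL0 n) rfl hinv hsqrt hL₁ hL₂
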